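/- Let $p\ge 1$ and $k\in\{1,\dots,5\}$ be integers, let $\tau$ lie in the upper half-plane $\mathbb H$, and write $q=e^{2\pi i\tau}$ and $q^r=e^{2\pi i r\tau}$ for $r\in\mathbb R$. Let $(x)_n=\prod_{j=0}^{n-1}(1-xq^j)$, $\left[{n\atop m}\right]_q=\frac{(q)_n}{(q)_m(q)_{n-m}}$, and let $\eta(\tau)=q^{1/24}\prod_{n\ge1}(1-q^n)$ be the Dedekind eta function. Define the Habiro-type series $$\begin{aligned} H_p^{(1)}(q)&=\sum_{s_p\ge\cdots\ge s_1\ge0}q^{s_p}(q^{s_p+1})_{s_p+1}\prod_{i=1}^{p-1}q^{s_i(s_i+1)}\left[{s_{i+1}\atop s_i}\right]_q,\\ H_p^{(2)}(q)&=\sum_{s_p\ge\cdots\ge s_1\ge0}q^{s_p}(q^{s_p})_{s_p}\prod_{i=1}^{p-1}q^{s_i^2}\left[{s_{i+1}\atop s_i}\right]_q,\\ H_p^{(3)}(q)&=\sum_{s_p\ge\cdots\ge s_1\ge0}q^{2s_p}(q^{s_p+1})_{s_p}\prod_{i=1}^{p-1}q^{s_i(s_i+1)}\left[{s_{i+1}\atop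 s_i}\right]_q,\\ H_p^{(4)}(q)&=\sum_{s_p\ge\cdots\ge s_1\ge0}q^{s_p}(q^{s_p+1})_{s_p}\prod_{i=1}^{p-1}q^{s_i(s_i+1)}\left[{s_{i+1}\atop s_i}\right]_q,\\ H_p^{(5)}(q)&=\sum_{s_p\ge\cdots\ge s_1\ge0}q^{s_p}(q^{s_p+1})_{s_p}\prod_{i=1}^{p-1}q^{s_i^2}\left[{s_{i+1}\atop s_i}\right]_q. \end{aligned}$$ Let $A=\begin{pmatrix}2p+1&2\\2&3\end{pmatrix}$, $B(x,y)=x^TAy$, $Q(x)=\tfrac12B(x,x)$, $L=2\mathbb Z^2$, $$c_1=\frac{1}{\sqrt{3(6p-1)}}\begin{pmatrix}3\\-2\end{pmatrix},\qquad c_2=\frac{1}{\sqrt{(2p+1)(6p-1)}}\begin{pmatrix}-2\\2p+1\end{pmatrix},$$ and, for $\mu$ in the dual lattice $\tfrac12A^{-1}\mathbb Z^2$ and $c\in\{c_1,c_2\}$, let $$\widetilde\theta^{(2)}_{\mu,c}(\tau)=\sum_{n\in L+\mu}\operatorname{sgn}(B(n,c))\,q^{Q(n)},\qquad \operatorname{sgn}(0)=0.$$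 Put $$\begin{aligned} \mu_1&=\tfrac12A^{-1}\begin{pmatrix}2p+1\\5\end{pmatrix}=\tfrac{1}{2(6p-1)}\begin{pmatrix}6p-7\\6p+3\end{pmatrix},& \mu_2&=\tfrac12A^{-1}\begin{pmatrix}1\\1\end{pmatrix}=\tfrac{1}{2(6p-1)}\begin{pmatrix}1\\2p-1\end{pmatrix},\\ \mu_3&=\tfrac12A^{-1}\begin{pmatrix}2p+3\\3\end{pmatrix}=\tfrac{1}{2(6p-1)}\begin{pmatrix}6p+3\\2p-3\end{pmatrix},& \mu_4&=\tfrac12A^{-1}\begin{pmatrix}2p+1\\1\end{pmatrix}=\tfrac{1}{2(6p-1)}\begin{pmatrix}6p+1\\-2p-1\end{pmatrix},\\ \mu_5&=\tfrac12A^{-1}\begin{pmatrix}1\\3\end{pmatrix}=\tfrac{1}{2(6p-1)}\begin{pmatrix}-3\\6p+1\end{pmatrix}, \end{aligned}$$ and $e_1=(6p+5)^2$, $e_2=1$, $e_3=36p^2+84p+1$, $e_4=(6p+1)^2$, $e_5=48p+1$. Then, except for $p=1$ with $k\in\{1,3\}$, for every $\tau\in\mathbb H$ all the series below converge absolutely and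 $$H_p^{(k)}(q)=\frac{q^{-\frac{e_k}{24(6p-1)}}}{2\eta(\tau)}\sum_{\varepsilon=(\varepsilon_1,\varepsilon_2)\in\{0,1\}^2}(-1)^{\varepsilon_1+\varepsilon_2}\Bigl(\widetilde\theta^{(2)}_{\mu_k+\varepsilon,c_1}(\tau)+\widetilde\theta^{(2)}_{\mu_k+\varepsilon,c_2}(\tau)\Bigr).$$ -/

import Mathlib

namespace HabiroFalse

noncomputable section

/-! ### The Habiro-type series -/

/-- The `q`-Pochhammer symbol `(x; q)_n = ∏_{k=0}^{n-1} (1 - x q^k)`. -/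
def qPoch (q x : ℂ) (n : ℕ) : ℂ := ∏ k ∈ Finset.range n, (1 - x * q ^ k)

/-- The `q`-binomial coefficient `(q)_n / ((q)_k (q)_{n-k})`; it is used for `k ≤ n` and
`0 < |q| < 1` only, so that no denominator vanishes. -/
def qBinom (q : ℂ) (n k : ℕ) : ℂ := qPoch q q n / (qPoch q q k * qPoch q q (n - k))

/-- The finite sequences `0 ≤ s_1 ≤ s_2 ≤ ⋯ ≤ s_p` of natural numbers, as functions of the index
that vanish outside `{1, …, p}`. -/
def Chain (p : ℕ) : Type :=
  {s : ℕ → ℕ // MonotoneOn s (Set.Icc 1 p) ∧ ∀ i, i ∉ Set.Icc 1 p → s i = 0}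

/-- The summand of the `k`-th Habiro-type series (`k = 1, …, 5`) at the sequence `s_1, …, s_p`. -/
def habiroTerm (p : ℕ) (k : ℕ) (q : ℂ) (s : ℕ → ℕ) : ℂ :=
  match k with
  | 1 => q ^ s p * qPoch q (q ^ (s p + 1)) (s p + 1) *
      ∏ i ∈ Finset.Icc 1 (p - 1), q ^ (s i * (s i + 1)) * qBinom q (s (i + 1)) (s i)
  | 2 => q ^ s p * qPoch q (q ^ s p) (s p) *
      ∏ i ∈ Finset.Icc 1 (p - 1), q ^ (s i ^ 2) * qBinom q (s (i + 1)) (s i)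
  | 3 => q ^ (2 * s p) * qPoch q (q ^ (s p + 1)) (s p) *
      ∏ i ∈ Finset.Icc 1 (p - 1), q ^ (s i * (s i + 1)) * qBinom q (s (i + 1)) (s i)
  | 4 => q ^ s p * qPoch q (q ^ (s p + 1)) (s p) *
      ∏ i ∈ Finset.Icc 1 (p - 1), q ^ (s i * (s i + 1)) * qBinom q (s (i + 1)) (s i)
  | 5 => q ^ s p * qPoch q (q ^ (s p + 1)) (s p) *
      ∏ i ∈ Finset.Icc 1 (p - 1), q ^ (s i ^ 2) * qBinom q (s (i + 1)) (s i)
  | _ => 0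

/-- The Habiro-type series `H_p^{(k)}(q)`, for `k = 1, …, 5` and `p ≥ 1`. -/
def habiro (p : ℕ) (k : ℕ) (q : ℂ) : ℂ := ∑' s : Chain p, habiroTerm p k q s.1

/-! ### False theta functions -/

/-- `q^x = e^{2πi x τ}` for real `x`. -/
def qPow (τ : UpperHalfPlane) (x : ℝ) : ℂ :=
  Complex.exp (2 * Real.pi * Complex.I * x * (τ : ℂ))

/-- The bilinear form `B(x, y) = xᵀ A y`. -/
def bilin {r : ℕ} (A : Matrix (Fin r) (Fin r) ℝ) (x y : Fin r → ℝ) : ℝ := x ⬝ᵥ A.mulVec y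

/-- The quadratic form `Q(x) = B(x, x) / 2`. -/
def quad {r : ℕ} (A : Matrix (Fin r) (Fin r) ℝ) (x : Fin r → ℝ) : ℝ := bilin A x x / 2

/-- The summand `sgn(B(n, c)) q^{Q(n)}` of a false theta function. -/
def falseThetaTerm {r : ℕ} (A : Matrix (Fin r) (Fin r) ℝ) (c : Fin r → ℝ)
    (τ : UpperHalfPlane) (n : Fin r → ℝ) : ℂ :=
  ((Real.sign (bilin A n c) : ℝ) : ℂ) * qPow τ (quad A n)

/-- The false theta function `∑_{n ∈ L + μ} sgn(B(n, c)) q^{Q(n)}`. -/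
def falseTheta {r : ℕ} (A : Matrix (Fin r) (Fin r) ℝ) (L : AddSubgroup (Fin r → ℝ))
    (μ c : Fin r → ℝ) (τ : UpperHalfPlane) : ℂ :=
  ∑' n : {n : Fin r → ℝ // n - μ ∈ L}, falseThetaTerm A c τ n.1

/-- The matrix `A = [[2p+1, 2], [2, 3]]`. -/
def matA (p : ℕ) : Matrix (Fin 2) (Fin 2) ℝ := !![2 * (p : ℝ) + 1, 2; 2, 3]

/-- The lattice `2ℤ²` in `ℝ²`. -/
def lattice : AddSubgroup (Fin 2 → ℝ) :=
  AddSubgroup.pi Set.univ fun _ => AddSubgroup.zmultiples (2 : ℝ)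

/-- `c₁ = (3, -2) / √(3(6p-1))`. -/
def c₁ (p : ℕ) : Fin 2 → ℝ := (1 / Real.sqrt (3 * (6 * (p : ℝ) - 1))) • ![3, -2]

/-- `c₂ = (-2, 2p+1) / √((2p+1)(6p-1))`. -/
def c₂ (p : ℕ) : Fin 2 → ℝ :=
  (1 / Real.sqrt ((2 * (p : ℝ) + 1) * (6 * (p : ℝ) - 1))) • ![-2, 2 * (p : ℝ) + 1]

/-- The integer vectors `m_k` for which the shifts are `μ_k = (1/2) A⁻¹ m_k`. -/
def intVec (p : ℕ) (k : ℕ) : Fin 2 → ℝ :=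
  match k with
  | 1 => ![2 * (p : ℝ) + 1, 5]
  | 2 => ![1, 1]
  | 3 => ![2 * (p : ℝ) + 3, 3]
  | 4 => ![2 * (p : ℝ) + 1, 1]
  | 5 => ![1, 3]
  | _ => 0

/-- The shift `μ_k = (1/2) A⁻¹ m_k`. -/
def shift (p : ℕ) (k : ℕ) : Fin 2 → ℝ := (1 / 2 : ℝ) • (matA p)⁻¹.mulVec (intVec p k)

/-- The explicit vector `2(6p-1) μ_k`. -/
def shiftNum (p : ℕ) (k : ℕ) : Fin 2 → ℝ :=
  match k with
  | 1 => ![6 * (p : ℝ) - 7, 6 * p + 3]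
  | 2 => ![1, 2 * (p : ℝ) - 1]
  | 3 => ![6 * (p : ℝ) + 3, 2 * p - 3]
  | 4 => ![6 * (p : ℝ) + 1, -2 * p - 1]
  | 5 => ![-3, 6 * (p : ℝ) + 1]
  | _ => 0

/-- The exponents `e_k`. -/
def expo (p : ℕ) (k : ℕ) : ℝ :=
  match k with
  | 1 => (6 * (p : ℝ) + 5) ^ 2
  | 2 => 1
  | 3 => 36 * (p : ℝ) ^ 2 + 84 * p + 1
  | 4 => (6 * (p : ℝ) + 1) ^ 2
  | 5 => 48 * (p : ℝ) + 1
  | _ => 0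

/-- An element `ε` of `{0,1}²`, as a vector in `ℝ²`. -/
def epsVec (ε : Fin 2 → Fin 2) : Fin 2 → ℝ := fun i => ((ε i : ℕ) : ℝ)

end

end HabiroFalse

/-!
Write `(q)_∞ = ∏_{n ≥ 1} (1 - q^n)`. Both sides of the identity, multiplied by `(q)_∞`, are the same
difference of two double theta-like series `∑_{n, r ≥ 0} (-1)^{n+r} q^{Q(n, r)}`, where the quadratic
part of the exponent is `(p + 1/2) n² + 2 n r + (3/2) r²`, the form of the matrix `A`.

On the side of the Habiro-type series, the inner sum over `s_1 ≤ ⋯ ≤ s_{p-1}` is an iterated Bailey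
chain, with both parameters sent to infinity, relative to `a = q` (for `k = 1, 3, 4`) or `a = 1` (for
`k = 2, 5`). It starts from the unit Bailey pair, so its value is a single sum over `n ≤ s_p` with
coefficients `± q^{p n² + ⋯}` (`nestedSum_eq`). Exchanging this sum with the one over `N = s_p`
(`bailey_transform`) leaves the conjugate Bailey pairs `∑_{N ≥ n} δ_N / ((q)_{N-n} (q)_{N+n+e})`,
where `δ_N` is essentially `q^N (q)_{2N}`. By the `q`-Pascal rules, each of them is a combination of
sums of near-central `q`-binomial coefficients `∑_j q^j [2j + M - 1 choose j]_q`. Telescoping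
`[2j + M choose j]_q`, which tends to `1 / (q)_∞`, gives a three-step recurrence in `M`; a bounded
solution of it is unique, and is the partial theta function
`(1 / (q)_∞) ∑_r (-1)^r q^{r(3r+1)/2 + M r}` (`centralSum_eq`). The result is `hasSum_habiro`.

On the side of the false theta functions, `B(n, c₁)` and `B(n, c₂)` are positive multiples of the two
coordinates of `n`. The alternating sum over `ε` therefore is a sum over `ℤ² + μ` with the factor
`sgn n₁ + sgn n₂`, which is `2` and `-2` on two opposite quadrants and `0` elsewhere
(`sum_falseTheta_quadrants`). The quadrants start at the integer points next to `-μ_k`; the two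
exceptional cases `p = 1`, `k ∈ {1, 3}` are those in which a coordinate of `μ_k`, positive for all
larger `p`, is negative, so that the quadrants no longer match the ranges of summation of the double
series. Finally
`Q(μ_k) = e_k / (24 (6p - 1)) + 1 / 24`, which accounts for the prefactor and for the power `q^{1/24}`
in `η`.
-/

namespace HabiroFalse

open Filter Topology Finset

/-! ### Finite and infinite `q`-factorials -/

/-- The infinite product `(q)_∞ = ∏_{n ≥ 1} (1 - q^n)`. -/
noncomputable def qInf (q : ℂ) : ℂ := ∏' n : ℕ, (1 - q ^ (n + 1))

/-- The `q`-factorial `(q)_n = (1 - q) ⋯ (1 - q^n)`. -/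
noncomputable def qFac (q : ℂ) (n : ℕ) : ℂ := qPoch q q n

/-- The `q`-binomial coefficient in its symmetric indexing, `(q)_{a+b} / ((q)_a (q)_b)`. -/
noncomputable def qChoose (q : ℂ) (a b : ℕ) : ℂ := qFac q (a + b) / (qFac q a * qFac q b)

@[simp] lemma qFac_zero (q : ℂ) : qFac q 0 = 1 := by simp [qFac, qPoch]

lemma qFac_succ (q : ℂ) (n : ℕ) : qFac q (n + 1) = qFac q n * (1 - q ^ (n + 1)) := by
  simp [qFac, qPoch, prod_range_succ, pow_succ']

lemma one_sub_pow_ne_zero {q : ℂ} (hq : ‖q‖ < 1) (n : ℕ) : 1 - q ^ (n + 1) ≠ 0 := by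
  intro h
  have h1 : ‖q ^ (n + 1)‖ < 1 := by
    rw [norm_pow]; exact pow_lt_one₀ (norm_nonneg _) hq (by simp)
  rw [← sub_eq_zero.mp h] at h1
  simp at h1

lemma one_add_pow_ne_zero {q : ℂ} (hq : ‖q‖ < 1) (n : ℕ) : 1 + q ^ (n + 1) ≠ 0 := by
  intro h
  have h1 : ‖q ^ (n + 1)‖ < 1 := by
    rw [norm_pow]; exact pow_lt_one₀ (norm_nonneg _) hq (by simp)
  rw [show q ^ (n + 1) = -1 by linear_combination h] at h1
  simp at h1

lemma qFac_ne_zero {q : ℂ} (hq : ‖q‖ < 1) (n : ℕ) : qFac q n ≠ 0 := by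
  induction n with
  | zero => simp
  | succ n ih => rw [qFac_succ]; exact mul_ne_zero ih (one_sub_pow_ne_zero hq n)

lemma qPoch_pow_succ {q : ℂ} (m n : ℕ) :
    qFac q m * qPoch q (q ^ (m + 1)) n = qFac q (m + n) := by
  induction n with
  | zero => simp [qPoch]
  | succ n ih =>
    have : qPoch q (q ^ (m + 1)) (n + 1)
        = qPoch q (q ^ (m + 1)) n * (1 - q ^ (m + n + 1)) := by
      rw [qPoch, prod_range_succ, ← pow_add, qPoch]; ring_nf
    rw [this, ← mul_assoc, ih, ← add_assoc, qFac_succ]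

lemma tendsto_qFac {q : ℂ} (hq : ‖q‖ < 1) : Tendsto (qFac q) atTop (𝓝 (qInf q)) := by
  have h := (ModularForm.multipliable_one_sub_pow hq).hasProd.tendsto_prod_nat
  refine h.congr fun n => ?_
  simp only [qFac, qPoch, ← pow_succ']

lemma qInf_ne_zero {q : ℂ} (hq : ‖q‖ < 1) : qInf q ≠ 0 := by
  refine tprod_one_add_ne_zero_of_summable (f := fun n : ℕ ↦ -q ^ (n + 1)) (fun n => ?_) ?_
  · simpa [sub_eq_add_neg] using one_sub_pow_ne_zero hq n
  · simpa using (summable_nat_add_iff 1).mpr (summable_geometric_of_lt_one (norm_nonneg _) hq)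

/-- A bound, uniform in `n`, for `(q)_n` and its inverse. -/
lemma exists_qFac_bound {q : ℂ} (hq : ‖q‖ < 1) :
    ∃ C : ℝ, 1 ≤ C ∧ ∀ n, ‖qFac q n‖ ≤ C ∧ ‖(qFac q n)⁻¹‖ ≤ C := by
  obtain ⟨C₁, h₁⟩ := (Metric.isBounded_range_of_tendsto _ (tendsto_qFac hq)).exists_norm_le
  obtain ⟨C₂, h₂⟩ := (Metric.isBounded_range_of_tendsto _
    ((tendsto_qFac hq).inv₀ (qInf_ne_zero hq))).exists_norm_le
  refine ⟨max 1 (max C₁ C₂), le_max_left _ _, fun n => ⟨?_, ?_⟩⟩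
  · exact (h₁ _ ⟨n, rfl⟩).trans ((le_max_left _ _).trans (le_max_right _ _))
  · exact (h₂ _ ⟨n, rfl⟩).trans ((le_max_right _ _).trans (le_max_right _ _))

lemma exists_qChoose_bound {q : ℂ} (hq : ‖q‖ < 1) :
    ∃ C : ℝ, 0 ≤ C ∧ ∀ a b, ‖qChoose q a b‖ ≤ C := by
  obtain ⟨C, hC, h⟩ := exists_qFac_bound hq
  refine ⟨C * (C * C), by positivity, fun a b => ?_⟩
  rw [qChoose, div_eq_mul_inv, mul_inv, norm_mul, norm_mul]
  gcongr
  exacts [(h _).1, (h _).2, (h _).2]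

lemma qChoose_zero_left {q : ℂ} (hq : ‖q‖ < 1) (b : ℕ) : qChoose q 0 b = 1 := by
  simp [qChoose, qFac_ne_zero hq]

lemma qChoose_comm (q : ℂ) (a b : ℕ) : qChoose q a b = qChoose q b a := by
  rw [qChoose, qChoose, add_comm, mul_comm (qFac q a)]

/-- The `q`-Pascal rule. -/
lemma qChoose_succ_succ {q : ℂ} (hq : ‖q‖ < 1) (a b : ℕ) :
    qChoose q (a + 1) (b + 1) =
      qChoose q a (b + 1) + q ^ (a + 1) * qChoose q (a + 1) b := by
  have h1 := qFac_ne_zero hq a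
  have h2 := qFac_ne_zero hq b
  have h3 := one_sub_pow_ne_zero hq a
  have h4 := one_sub_pow_ne_zero hq b
  simp only [qChoose, show a + 1 + (b + 1) = a + b + 1 + 1 by ring,
    show a + (b + 1) = a + b + 1 by ring, show a + 1 + b = a + b + 1 by ring, qFac_succ]
  field_simp
  ring

/-- The mirror image of the `q`-Pascal rule `qChoose_succ_succ`. -/
lemma qChoose_succ_succ' {q : ℂ} (hq : ‖q‖ < 1) (a b : ℕ) :
    qChoose q (a + 1) (b + 1) =
      q ^ (b + 1) * qChoose q a (b + 1) + qChoose q (a + 1) b := by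
  rw [qChoose_comm, qChoose_succ_succ hq, qChoose_comm q b, qChoose_comm q (b + 1), add_comm]

lemma tendsto_qChoose {q : ℂ} (hq : ‖q‖ < 1) (m : ℕ) :
    Tendsto (fun j => qChoose q j (j + m)) atTop (𝓝 (qInf q)⁻¹) := by
  have h := tendsto_qFac hq
  have hE := qInf_ne_zero hq
  have hm : Tendsto (fun j => qFac q (j + m)) atTop (𝓝 (qInf q)) :=
    (tendsto_add_atTop_iff_nat m).mpr h
  have h2 : Tendsto (fun j => qFac q (j + (j + m))) atTop (𝓝 (qInf q)) :=
    h.comp (tendsto_atTop_mono (fun j => Nat.le_add_right j (j + m)) tendsto_id)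
  have := h2.div (h.mul hm) (mul_ne_zero hE hE)
  rwa [div_mul_cancel_left₀ hE] at this

/-! ### Sums of near-central `q`-binomial coefficients as partial theta functions -/

/-- The sum `∑_{j ≥ 0} q^j [2j + M - 1 choose j]_q`. The term `j = 0` is split off, so that it has
the value `1` also for `M = 0`. -/
noncomputable def centralSum (q : ℂ) (M : ℕ) : ℂ :=
  1 + ∑' j : ℕ, q ^ (j + 1) * qChoose q (j + 1) (j + M)

lemma summable_pow_mul_qChoose {q : ℂ} (hq : ‖q‖ < 1) (a b : ℕ) (f : ℕ → ℕ)
    (hf : ∀ j, j ≤ f j) :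
    Summable fun j : ℕ => q ^ f j * qChoose q (j + a) (j + b) := by
  obtain ⟨C, hC, h⟩ := exists_qChoose_bound hq
  refine Summable.of_norm_bounded
    ((summable_geometric_of_lt_one (norm_nonneg _) hq).mul_right C) fun j => ?_
  rw [norm_mul, norm_pow]
  exact mul_le_mul (pow_le_pow_of_le_one (norm_nonneg _) hq.le (hf j)) (h _ _)
    (norm_nonneg _) (by positivity)

lemma centralSum_succ {q : ℂ} (hq : ‖q‖ < 1) (m : ℕ) :
    centralSum q (m + 1) = ∑' j : ℕ, q ^ j * qChoose q j (j + m) := by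
  have h := summable_pow_mul_qChoose hq 0 m id fun _ => le_rfl
  simp only [add_zero, id] at h
  rw [h.tsum_eq_zero_add]
  simp only [zero_add, pow_zero, one_mul, qChoose_zero_left hq, centralSum]
  congr 1
  exact tsum_congr fun j => by rw [show j + (m + 1) = j + 1 + m by ring]

/-- The recurrence comes from telescoping `U_{j+1} - U_j` for `U_j = [2j + M choose j]_q`, which
tends to `1 / (q)_∞`. -/
lemma centralSum_recurrence {q : ℂ} (hq : ‖q‖ < 1) (M : ℕ) :
    centralSum q M = (qInf q)⁻¹ - q ^ (M + 2) * centralSum q (M + 3) := by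
  set U : ℕ → ℂ := fun j => qChoose q j (j + M)
  set B : ℕ → ℂ := fun j => match j with
    | 0 => 0
    | j + 1 => q ^ (M + 2) * (q ^ j * qChoose q j (j + (M + 2)))
  have hstep : ∀ j, U (j + 1) - U j = q ^ (j + 1) * qChoose q (j + 1) (j + M) + B j := by
    intro j
    have h1 : U (j + 1) = qChoose q j (j + M + 1)
        + q ^ (j + 1) * qChoose q (j + 1) (j + M) := by
      simp only [U]
      rw [show j + 1 + M = j + M + 1 by ring, qChoose_succ_succ hq]
    cases j with
    | zero => rw [h1]; simp [U, B, qChoose_zero_left hq]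
    | succ j =>
      rw [h1, show j + 1 + M + 1 = (j + M + 1) + 1 by ring, qChoose_succ_succ' hq]
      simp only [U, B, show j + 1 + M = j + M + 1 by ring,
        show j + (M + 2) = j + M + 1 + 1 by ring]
      ring
  have hA : Summable fun j : ℕ => q ^ (j + 1) * qChoose q (j + 1) (j + M) :=
    summable_pow_mul_qChoose hq 1 M (· + 1) fun j => Nat.le_succ j
  have hB' : Summable fun j : ℕ => q ^ j * qChoose q j (j + (M + 2)) :=
    summable_pow_mul_qChoose hq 0 (M + 2) id fun _ => le_rfl
  have hB : HasSum B (q ^ (M + 2) * centralSum q (M + 3)) := by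
    rw [← hasSum_nat_add_iff' 1]
    simp only [range_one, sum_singleton, B, sub_zero]
    rw [show M + 3 = M + 2 + 1 by ring, centralSum_succ hq]
    exact hB'.hasSum.mul_left _
  have hsum := hA.hasSum.add hB
  have ht : Tendsto (fun n => ∑ j ∈ range n, (U (j + 1) - U j)) atTop
      (𝓝 ((qInf q)⁻¹ - U 0)) := by
    simp only [sum_range_sub]
    exact (tendsto_qChoose hq M).sub_const _
  have heq := tendsto_nhds_unique ht
    ((hsum.tendsto_sum_nat).congr fun n => sum_congr rfl fun j _ => (hstep j).symm)
  simp only [U, qChoose_zero_left hq] at heq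
  rw [centralSum]
  linear_combination -heq

lemma exists_centralSum_bound {q : ℂ} (hq : ‖q‖ < 1) :
    ∃ C : ℝ, ∀ M, ‖centralSum q M‖ ≤ C := by
  obtain ⟨C, hC, h⟩ := exists_qChoose_bound hq
  have hg := (summable_geometric_of_lt_one (norm_nonneg _) hq).mul_right C
  refine ⟨1 + ∑' j : ℕ, ‖q‖ ^ j * C, fun M => ?_⟩
  refine (norm_add_le _ _).trans ?_
  rw [norm_one]
  gcongr
  refine tsum_of_norm_bounded hg.hasSum fun j => ?_
  rw [norm_mul, norm_pow]
  exact mul_le_mul (pow_le_pow_of_le_one (norm_nonneg _) hq.le (Nat.le_succ j)) (h _ _)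
    (norm_nonneg _) (by positivity)

lemma summable_partialTheta {q : ℂ} (hq : ‖q‖ < 1) (M : ℕ) :
    Summable fun r : ℕ => (-1 : ℂ) ^ r * q ^ (3 * r.choose 2 + 2 * r + M * r) := by
  refine Summable.of_norm_bounded (summable_geometric_of_lt_one (norm_nonneg _) hq) fun r => ?_
  rw [norm_mul, norm_pow, norm_neg, norm_one, one_pow, one_mul, norm_pow]
  exact pow_le_pow_of_le_one (norm_nonneg _) hq.le (by nlinarith [Nat.zero_le (M * r)])

lemma partialTheta_recurrence {q : ℂ} (hq : ‖q‖ < 1) (M : ℕ) :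
    ∑' r : ℕ, (-1 : ℂ) ^ r * q ^ (3 * r.choose 2 + 2 * r + M * r) =
      1 - q ^ (M + 2) *
        ∑' r : ℕ, (-1 : ℂ) ^ r * q ^ (3 * r.choose 2 + 2 * r + (M + 3) * r) := by
  rw [(summable_partialTheta hq M).tsum_eq_zero_add, ← tsum_mul_left, sub_eq_add_neg, ← tsum_neg]
  congr 1
  · simp
  · refine tsum_congr fun r => ?_
    rw [Nat.choose_succ_succ' r 1, Nat.choose_one_right]
    ring

/-- Both sides satisfy the recurrence `F M = 1/(q)_∞ - q^{M+2} F (M+3)`, which has only one bounded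
solution. -/
lemma centralSum_eq {q : ℂ} (hq : ‖q‖ < 1) (M : ℕ) :
    centralSum q M =
      (qInf q)⁻¹ * ∑' r : ℕ, (-1 : ℂ) ^ r * q ^ (3 * r.choose 2 + 2 * r + M * r) := by
  set P : ℕ → ℂ := fun M => ∑' r : ℕ, (-1 : ℂ) ^ r * q ^ (3 * r.choose 2 + 2 * r + M * r)
  set D : ℕ → ℂ := fun M => centralSum q M - (qInf q)⁻¹ * P M
  obtain ⟨C₁, h₁⟩ := exists_centralSum_bound hq
  have hP : ∀ M, ‖P M‖ ≤ ∑' r : ℕ, ‖q‖ ^ r := fun M => by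
    refine tsum_of_norm_bounded (summable_geometric_of_lt_one (norm_nonneg _) hq).hasSum
      fun r => ?_
    rw [norm_mul, norm_pow, norm_neg, norm_one, one_pow, one_mul, norm_pow]
    exact pow_le_pow_of_le_one (norm_nonneg _) hq.le (by nlinarith [Nat.zero_le (M * r)])
  obtain ⟨C, hC⟩ : ∃ C : ℝ, ∀ M, ‖D M‖ ≤ C :=
    ⟨C₁ + ‖(qInf q)⁻¹‖ * ∑' r : ℕ, ‖q‖ ^ r, fun M => (norm_sub_le _ _).trans (by
      rw [norm_mul]
      exact add_le_add (h₁ M) (mul_le_mul_of_nonneg_left (hP M) (norm_nonneg _)))⟩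
  have hD : ∀ M, D M = -q ^ (M + 2) * D (M + 3) := fun M => by
    simp only [D]
    rw [centralSum_recurrence hq M, show P M = 1 - q ^ (M + 2) * P (M + 3) from
      partialTheta_recurrence hq M]
    ring
  have hstep : ∀ M, ‖D M‖ ≤ ‖q‖ * ‖D (M + 3)‖ := fun M => by
    rw [hD M, norm_mul, norm_neg, norm_pow]
    gcongr
    exact pow_le_of_le_one (norm_nonneg _) hq.le (by simp)
  have hiter : ∀ k M, ‖D M‖ ≤ ‖q‖ ^ k * C := by
    intro k
    induction k with
    | zero => simpa using hC
    | succ k ih =>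
      intro M
      rw [pow_succ', mul_assoc]
      exact (hstep M).trans (mul_le_mul_of_nonneg_left (ih _) (norm_nonneg _))
  have hlim : Tendsto (fun k => ‖q‖ ^ k * C) atTop (𝓝 0) := by
    simpa using (tendsto_pow_atTop_nhds_zero_of_lt_one (norm_nonneg _) hq).mul_const C
  have h0 : ‖D M‖ ≤ 0 := ge_of_tendsto' hlim fun k => hiter k M
  exact sub_eq_zero.mp (norm_le_zero_iff.mp h0)

/-- The analogue of `centralSum` with `q^{2j}` in place of `q^j`, expressed through `centralSum`. -/
lemma tsum_sq_qChoose {q : ℂ} (hq : ‖q‖ < 1) (m : ℕ) :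
    ∑' j : ℕ, q ^ (2 * j) * qChoose q j (j + m) =
      centralSum q (m + 2) - q * centralSum q (m + 3) := by
  rw [show m + 2 = (m + 1) + 1 by ring, show m + 3 = (m + 2) + 1 by ring, centralSum_succ hq,
    centralSum_succ hq]
  have h1 := summable_pow_mul_qChoose hq 0 (m + 1) id fun _ => le_rfl
  have h2 := summable_pow_mul_qChoose hq 0 (m + 2) id fun _ => le_rfl
  have h3 := summable_pow_mul_qChoose hq 0 m (2 * ·) fun j => by omega
  simp only [add_zero, id] at h1 h2 h3
  have h4 : Summable fun j : ℕ => q ^ (2 * (j + 1)) * qChoose q (j + 1) (j + 1 + m) :=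
    (summable_nat_add_iff 1).mpr h3
  rw [h1.tsum_eq_zero_add, h3.tsum_eq_zero_add, ← tsum_mul_left]
  have : ∀ j : ℕ, q ^ (j + 1) * qChoose q (j + 1) (j + 1 + (m + 1)) =
      q ^ (2 * (j + 1)) * qChoose q (j + 1) (j + 1 + m)
        + q * (q ^ j * qChoose q j (j + (m + 2))) := fun j => by
    rw [show j + 1 + (m + 1) = (j + m + 1) + 1 by ring, qChoose_succ_succ hq,
      show j + 1 + m = j + m + 1 by ring, show j + (m + 2) = j + m + 1 + 1 by ring]
    ring
  rw [tsum_congr this, h4.tsum_add (h2.mul_left q)]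
  simp only [pow_zero, mul_zero, qChoose_zero_left hq]
  ring

/-- A second relation between the sums with `q^{2j}` and those with `q^j`, from the other
`q`-Pascal rule. -/
lemma tsum_sq_qChoose' {q : ℂ} (hq : ‖q‖ < 1) (m : ℕ) :
    q ^ (m + 3) * ∑' j : ℕ, q ^ (2 * j) * qChoose q j (j + (m + 2)) =
      centralSum q (m + 2) - centralSum q (m + 1) := by
  rw [show m + 2 = (m + 1) + 1 by ring, centralSum_succ hq, centralSum_succ hq]
  have h1 := summable_pow_mul_qChoose hq 0 (m + 1) id fun _ => le_rfl
  have h2 := summable_pow_mul_qChoose hq 0 m id fun _ => le_rfl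
  have h3 := summable_pow_mul_qChoose hq 0 (m + 2) (2 * ·) fun j => by omega
  simp only [add_zero, id] at h1 h2 h3
  have h4 : Summable fun j : ℕ => q ^ (j + 1) * qChoose q (j + 1) (j + 1 + m) :=
    (summable_nat_add_iff 1).mpr h2
  rw [h1.tsum_eq_zero_add, h2.tsum_eq_zero_add, ← tsum_mul_left]
  have : ∀ j : ℕ, q ^ (j + 1) * qChoose q (j + 1) (j + 1 + (m + 1)) =
      q ^ (j + 1) * qChoose q (j + 1) (j + 1 + m)
        + q ^ (m + 3) * (q ^ (2 * j) * qChoose q j (j + (m + 2))) := fun j => by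
    rw [show j + 1 + (m + 1) = (j + m + 1) + 1 by ring, qChoose_succ_succ' hq,
      show j + 1 + m = j + m + 1 by ring, show j + (m + 2) = j + m + 1 + 1 by ring]
    ring
  rw [tsum_congr this, h4.tsum_add (h3.mul_left _)]
  simp [qChoose_zero_left hq]

/-! ### The Bailey chain -/

/-- The `n`-th coefficient `1 / ((q)_{N-n} (q)_{N+n+e})` in the Bailey transform. It is
the usual kernel `1 / ((q)_{N-n} (aq)_{N+n})` relative to `a = q^e`, divided by `(q)_e`. -/
noncomputable def baileyKernel (q : ℂ) (e N n : ℕ) : ℂ :=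
  (qFac q (N - n) * qFac q (N + n + e))⁻¹

/-- A limiting case of the `q`-Chu–Vandermonde sum. By the `q`-Pascal rule, the left side for
`(M + 1, c)` equals the left side for `(M, c + 1)`. -/
lemma sum_qVandermonde {q : ℂ} (hq : ‖q‖ < 1) (M c : ℕ) :
    ∑ j ∈ range (M + 1), q ^ (j * (j + c)) * qBinom q M j * (qFac q (j + c))⁻¹ =
      (qFac q (M + c))⁻¹ := by
  induction M generalizing c with
  | zero => simp [qBinom, qPoch]
  | succ M ih =>
    rw [show M + 1 + c = M + (c + 1) by ring, ← ih (c + 1)]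
    -- `[M+1, j] = q^j [M, j] + [M, j-1]`, with the second sum re-indexed
    set f : ℕ → ℂ := fun j => if j ≤ M then
      q ^ (j * (j + c) + j) * qBinom q M j * (qFac q (j + c))⁻¹ else 0
    set g : ℕ → ℂ := fun j => q ^ ((j + 1) * (j + 1 + c)) * qBinom q M j
      * (qFac q (j + 1 + c))⁻¹
    have hF := fun n => qFac_ne_zero hq n
    have hS := fun n => one_sub_pow_ne_zero hq n
    have hself : ∀ n, qBinom q n n = 1 := fun n => by
      rw [qBinom, Nat.sub_self]
      change qFac q n / (qFac q n * qFac q 0) = 1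
      simp [hF n]
    have hzero : ∀ n, qBinom q n 0 = 1 := fun n => by
      rw [qBinom, Nat.sub_zero]
      change qFac q n / (qFac q 0 * qFac q n) = 1
      simp [hF n]
    have hpascal : ∀ j ≤ M, q ^ ((j + 1) * (j + 1 + c)) * qBinom q (M + 1) (j + 1)
        * (qFac q (j + 1 + c))⁻¹ = f (j + 1) + g j := by
      intro j hj
      obtain ⟨d, rfl⟩ := Nat.exists_eq_add_of_le hj
      cases d with
      | zero => simp [f, g, hself]
      | succ d =>
        have h1 : qBinom q (j + (d + 1) + 1) (j + 1) = qChoose q (j + 1) (d + 1) := by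
          rw [qBinom, qChoose, show j + (d + 1) + 1 - (j + 1) = d + 1 by omega,
            show j + 1 + (d + 1) = j + (d + 1) + 1 by ring]; rfl
        have h2 : qBinom q (j + (d + 1)) (j + 1) = qChoose q (j + 1) d := by
          rw [qBinom, qChoose, show j + (d + 1) - (j + 1) = d by omega,
            show j + 1 + d = j + (d + 1) by ring]; rfl
        have h3 : qBinom q (j + (d + 1)) j = qChoose q j (d + 1) := by
          rw [qBinom, qChoose, show j + (d + 1) - j = d + 1 by omega]; rfl
        simp only [f, g, show j + 1 ≤ j + (d + 1) by omega, if_true, h1, h2, h3,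
          qChoose_succ_succ hq]
        ring
    rw [sum_range_succ' _ (M + 1), sum_congr rfl fun j hj =>
      hpascal j (Nat.lt_succ_iff.mp (mem_range.mp hj)), sum_add_distrib]
    have hf0 : q ^ (0 * (0 + c)) * qBinom q (M + 1) 0 * (qFac q (0 + c))⁻¹ = f 0 := by
      simp [f, hzero]
    rw [hf0, add_right_comm, ← sum_range_succ' f (M + 1), sum_range_succ f (M + 1),
      show f (M + 1) = 0 by simp [f], add_zero, ← sum_add_distrib]
    refine sum_congr rfl fun j hj => ?_
    have hj' : j ≤ M := Nat.lt_succ_iff.mp (mem_range.mp hj)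
    simp only [f, g, hj', if_true]
    have h1 := hF (j + c)
    have h2 := hS (j + c)
    rw [show j + 1 + c = j + c + 1 by ring, show j + (c + 1) = j + c + 1 by ring, qFac_succ]
    field_simp
    ring

/-- One step of the Bailey chain, with both parameters sent to infinity. -/
lemma bailey_step {q : ℂ} (hq : ‖q‖ < 1) (e : ℕ) (a β : ℕ → ℂ)
    (h : ∀ N, β N = ∑ n ∈ range (N + 1), a n * baileyKernel q e N n) (N : ℕ) :
    ∑ s ∈ range (N + 1), q ^ (s ^ 2 + e * s) * (qFac q (N - s))⁻¹ * β s =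
      ∑ n ∈ range (N + 1), a n * q ^ (n ^ 2 + e * n) * baileyKernel q e N n := by
  simp_rw [h, mul_sum]
  rw [sum_sigma']
  have hF := fun n => qFac_ne_zero hq n
  -- exchange the sums over `n ≤ s ≤ N`
  have hex : ∑ x ∈ (range (N + 1)).sigma fun s => range (s + 1),
      q ^ (x.1 ^ 2 + e * x.1) * (qFac q (N - x.1))⁻¹ * (a x.2 * baileyKernel q e x.1 x.2) =
      ∑ x ∈ (range (N + 1)).sigma fun n => range (N - n + 1),
      q ^ ((x.1 + x.2) ^ 2 + e * (x.1 + x.2)) * (qFac q (N - (x.1 + x.2)))⁻¹ *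
        (a x.1 * baileyKernel q e (x.1 + x.2) x.1) := by
    refine sum_nbij' (fun x => ⟨x.2, x.1 - x.2⟩) (fun x => ⟨x.1 + x.2, x.1⟩) ?_ ?_ ?_ ?_ ?_
    · rintro ⟨s, n⟩ hx
      simp only [mem_sigma, mem_range] at hx ⊢
      omega
    · rintro ⟨n, j⟩ hx
      simp only [mem_sigma, mem_range] at hx ⊢
      omega
    · rintro ⟨s, n⟩ hx
      simp only [mem_sigma, mem_range] at hx
      simp only [Sigma.mk.injEq, heq_eq_eq, and_true]
      omega
    · rintro ⟨n, j⟩ hx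
      simp
    · rintro ⟨s, n⟩ hx
      simp only [mem_sigma, mem_range] at hx
      simp only [show n + (s - n) = s by omega]
  rw [hex, sum_sigma]
  refine sum_congr rfl fun n hn => ?_
  dsimp only
  obtain ⟨M, rfl⟩ := Nat.exists_eq_add_of_le (Nat.lt_succ_iff.mp (mem_range.mp hn))
  have hV := sum_qVandermonde hq M (2 * n + e)
  rw [baileyKernel, show n + M - n = M by omega, mul_inv,
    show n + M + n + e = M + (2 * n + e) by ring, ← hV, mul_sum, mul_sum]
  refine sum_congr rfl fun j hj => ?_
  have hj' : j ≤ M := Nat.lt_succ_iff.mp (mem_range.mp hj)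
  rw [show n + M - (n + j) = M - j by omega, baileyKernel, show n + j - n = j by omega,
    show n + j + n + e = j + (2 * n + e) by ring, qBinom]
  change _ = _ * (_ * (_ * (qFac q M / (qFac q j * qFac q (M - j))) * _))
  have h1 := hF M
  have h2 := hF j
  have h3 := hF (M - j)
  have h4 := hF (j + (2 * n + e))
  field_simp
  ring

/-- The coefficients `α_n` of the unit Bailey pair relative to `a = q`, times `1 - q`. -/
noncomputable def unitCoeffOdd (q : ℂ) (n : ℕ) : ℂ :=
  (-1) ^ n * q ^ n.choose 2 * (1 - q ^ (2 * n + 1))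

/-- The coefficients `α_n` of the unit Bailey pair relative to `a = 1`, which are
`(-1)^n q^{n(n-1)/2} (1 + q^n)` for `n ≥ 1`, and `1` for `n = 0`. -/
noncomputable def unitCoeffEven (q : ℂ) (n : ℕ) : ℂ :=
  (-1) ^ n * q ^ (n.choose 2 + n) + if n = 0 then 0 else (-1) ^ n * q ^ n.choose 2

lemma choose_two_succ (n : ℕ) : (n + 1).choose 2 = n.choose 2 + n := by
  rw [Nat.choose_succ_succ' n 1, Nat.choose_one_right, add_comm]

/-- The unit Bailey pair relative to `a = q`; the partial sums telescope. -/
lemma sum_unitCoeffOdd {q : ℂ} (hq : ‖q‖ < 1) (N : ℕ) :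
    ∑ n ∈ range (N + 1), unitCoeffOdd q n * baileyKernel q 1 N n = if N = 0 then 1 else 0 := by
  have hF := fun n => qFac_ne_zero hq n
  have hS := fun n => one_sub_pow_ne_zero hq n
  cases N with
  | zero =>
    have h1 := hF 1
    simp [unitCoeffOdd, baileyKernel, qFac_succ]
    simp [qFac_succ] at h1
    exact mul_inv_cancel₀ h1
  | succ N =>
    have hpart : ∀ k ≤ N, ∑ n ∈ range (k + 1), unitCoeffOdd q n * baileyKernel q 1 (N + 1) n =
        (-1) ^ k * q ^ (k + 1).choose 2 * (1 - q ^ (k + 1)) /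
          ((1 - q ^ (N + 1)) * (qFac q (N - k) * qFac q (N + 1 + k + 1))) := by
      intro k
      induction k with
      | zero =>
        intro _
        have h1 := hF N
        have h2 := hS N
        have h3 := hF (N + 1 + 1)
        simp [unitCoeffOdd, baileyKernel, qFac_succ q N]
        field_simp
      | succ k ih =>
        intro hk
        obtain ⟨d, rfl⟩ := Nat.exists_eq_add_of_le hk
        rw [sum_range_succ, ih (by omega), unitCoeffOdd, baileyKernel,
          show k + 1 + d - k = d + 1 by omega, show k + 1 + d - (k + 1) = d by omega,
          show k + 1 + d + 1 - (k + 1) = d + 1 by omega,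
          show k + 1 + d + 1 + (k + 1) + 1 = (k + 1 + d + 1 + k + 1) + 1 by ring,
          qFac_succ q d, qFac_succ q (k + 1 + d + 1 + k + 1), choose_two_succ (k + 1)]
        have h1 := hF d
        have h2 := hS d
        have h3 := hF (k + 1 + d + 1 + k + 1)
        have h4 := hS (k + 1 + d + 1 + k + 1)
        have h5 := hS (k + 1 + d)
        field_simp
        ring
    rw [sum_range_succ, hpart N le_rfl, unitCoeffOdd, baileyKernel,
      show N + 1 + (N + 1) + 1 = (N + 1 + N + 1) + 1 by ring,
      qFac_succ q (N + 1 + N + 1)]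
    have h3 := hF (N + 1 + N + 1)
    have h4 := hS (N + 1 + N + 1)
    have h5 := hS N
    simp only [Nat.sub_self, qFac_zero, Nat.add_eq_zero_iff, one_ne_zero, and_false, if_false]
    field_simp
    ring

/-- The unit Bailey pair relative to `a = 1`; the partial sums telescope. -/
lemma sum_unitCoeffEven {q : ℂ} (hq : ‖q‖ < 1) (N : ℕ) :
    ∑ n ∈ range (N + 1), unitCoeffEven q n * baileyKernel q 0 N n = if N = 0 then 1 else 0 := by
  have hF := fun n => qFac_ne_zero hq n
  have hS := fun n => one_sub_pow_ne_zero hq n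
  cases N with
  | zero => simp [unitCoeffEven, baileyKernel]
  | succ N =>
    have hpart : ∀ k ≤ N, ∑ n ∈ range (k + 1), unitCoeffEven q n * baileyKernel q 0 (N + 1) n =
        (-1) ^ k * q ^ (k + 1).choose 2 /
          ((1 - q ^ (N + 1)) * (qFac q (N - k) * qFac q (N + 1 + k))) := by
      intro k
      induction k with
      | zero =>
        intro _
        have h1 := hF N
        have h2 := hS N
        simp [unitCoeffEven, baileyKernel, qFac_succ q N]
        field_simp
      | succ k ih =>
        intro hk
        obtain ⟨d, rfl⟩ := Nat.exists_eq_add_of_le hk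
        rw [sum_range_succ, ih (by omega), unitCoeffEven, baileyKernel,
          show k + 1 + d - k = d + 1 by omega, show k + 1 + d - (k + 1) = d by omega,
          show k + 1 + d + 1 - (k + 1) = d + 1 by omega,
          show k + 1 + d + 1 + (k + 1) + 0 = (k + 1 + d + 1 + k) + 1 by ring,
          show k + 1 + d + 1 + (k + 1) = (k + 1 + d + 1 + k) + 1 by ring,
          qFac_succ q d, qFac_succ q (k + 1 + d + 1 + k), choose_two_succ (k + 1),
          if_neg (Nat.succ_ne_zero k)]
        have h1 := hF d
        have h2 := hS d
        have h3 := hF (k + 1 + d + 1 + k)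
        have h4 := hS (k + 1 + d + 1 + k)
        have h5 := hS (k + 1 + d)
        field_simp
        ring
    rw [sum_range_succ, hpart N le_rfl, unitCoeffEven, baileyKernel,
      show N + 1 + (N + 1) + 0 = (N + 1 + N) + 1 by ring,
      qFac_succ q (N + 1 + N), if_neg (Nat.succ_ne_zero N)]
    have h3 := hF (N + 1 + N)
    have h4 := hS (N + 1 + N)
    have h5 := hS N
    simp only [Nat.sub_self, qFac_zero, Nat.add_eq_zero_iff, one_ne_zero, and_false, if_false]
    field_simp
    ring

/-- The iterated sum `∑_{s_m ≤ ⋯}` of products of weights `w s_i s_{i+1}` over the chains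
`s_1 ≤ ⋯ ≤ s_m ≤ s_{m+1} = N`. -/
def nestedSum {R : Type*} [CommSemiring R] (w : ℕ → ℕ → R) : ℕ → ℕ → R
  | 0, _ => 1
  | m + 1, N => ∑ s ∈ range (N + 1), w s N * nestedSum w m s

/-- The weight `q^{s² + e s} [N choose s]_q` of one step of a chain. -/
noncomputable def stepWeight (q : ℂ) (e s N : ℕ) : ℂ := q ^ (s ^ 2 + e * s) * qBinom q N s

/-- Iterating the Bailey chain from a unit pair. -/
lemma nestedSum_eq {q : ℂ} (hq : ‖q‖ < 1) (e : ℕ) (a : ℕ → ℂ)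
    (ha : ∀ N, ∑ n ∈ range (N + 1), a n * baileyKernel q e N n = if N = 0 then 1 else 0)
    (m N : ℕ) :
    nestedSum (stepWeight q e) m N * (qFac q N)⁻¹ =
      ∑ n ∈ range (N + 1), a n * q ^ ((m + 1) * (n ^ 2 + e * n)) * baileyKernel q e N n := by
  induction m generalizing N with
  | zero =>
    have := bailey_step hq e a (fun N => if N = 0 then 1 else 0) (fun N => (ha N).symm) N
    rw [sum_eq_single 0 (by intro b _ hb; simp [hb]) (by simp)] at this
    simpa [nestedSum] using this
  | succ m ih =>
    have := bailey_step hq e _ _ ih N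
    simp_rw [mul_assoc (a _), ← pow_add] at this
    simp_rw [show ∀ n : ℕ, (m + 1 + 1) * (n ^ 2 + e * n) =
      (m + 1) * (n ^ 2 + e * n) + (n ^ 2 + e * n) from fun n => by ring, mul_assoc (a _)]
    rw [← this, nestedSum, sum_mul]
    refine sum_congr rfl fun s _ => ?_
    rw [stepWeight, qBinom]
    change _ * (qFac q N / (qFac q s * qFac q (N - s))) * _ * _ = _
    have h1 := qFac_ne_zero hq N
    have h2 := qFac_ne_zero hq s
    have h3 := qFac_ne_zero hq (N - s)
    field_simp

/-! ### Summation over chains -/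

/-- The chains `s_1 ≤ ⋯ ≤ s_p` with prescribed last entry `s_p = N`. -/
abbrev ChainEnd (p N : ℕ) : Type := {s : Chain p // s.1 p = N}

/-- The chains of length one with last entry `N`: there is exactly one. -/
@[reducible] def chainEndOne (N : ℕ) : Unique (ChainEnd 1 N) where
  default := ⟨⟨fun i => if i = 1 then N else 0, by
    refine ⟨fun i hi j hj _ => ?_, fun i hi => ?_⟩
    · simp only [Set.mem_Icc] at hi hj
      simp [show i = 1 by omega, show j = 1 by omega]
    · simp only [Set.Icc_self, Set.mem_singleton_iff] at hi
      simp [hi]⟩, by simp⟩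
  uniq := by
    rintro ⟨⟨s, hs, hs'⟩, h⟩
    refine Subtype.ext (Subtype.ext (funext fun i => ?_))
    by_cases hi : i = 1
    · subst hi; simpa using h
    · simpa [hi] using hs' i (by simpa using hi)

lemma sigma_chainEnd_ext {p N : ℕ} {x y : Σ m : Fin (N + 1), ChainEnd p m}
    (h : x.2.1.1 = y.2.1.1) : x = y := by
  obtain ⟨⟨m, hm⟩, ⟨c, hc⟩⟩ := x
  obtain ⟨⟨m', hm'⟩, ⟨c', hc'⟩⟩ := y
  obtain rfl : c = c' := Subtype.ext h
  dsimp only at hc hc'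
  subst hc
  subst hc'
  rfl

/-- Removing the last entry of a chain of length `p + 1` leaves a chain of length `p`. -/
def chainEndSucc (p N : ℕ) (hp : 1 ≤ p) :
    ChainEnd (p + 1) N ≃ Σ m : Fin (N + 1), ChainEnd p m where
  toFun s := ⟨⟨s.1.1 p, Nat.lt_succ_of_le (by
      have := s.1.2.1 (show p ∈ Set.Icc 1 (p + 1) from ⟨hp, by omega⟩)
        (show p + 1 ∈ Set.Icc 1 (p + 1) from ⟨by omega, le_rfl⟩) (by omega)
      rwa [s.2] at this)⟩,
    ⟨⟨fun i => if i = p + 1 then 0 else s.1.1 i, by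
      refine ⟨fun i hi j hj hij => ?_, fun i hi => ?_⟩
      · simp only [Set.mem_Icc] at hi hj
        simp only [show i ≠ p + 1 by omega, show j ≠ p + 1 by omega, if_false]
        exact s.1.2.1 ⟨hi.1, by omega⟩ ⟨hj.1, by omega⟩ hij
      · by_cases h : i = p + 1
        · simp [h]
        · simp only [h, if_false]
          refine s.1.2.2 i fun h' => hi ?_
          simp only [Set.mem_Icc] at h' ⊢
          omega⟩, by simp⟩⟩
  invFun x := ⟨⟨fun i => if i = p + 1 then N else x.2.1.1 i, by
      refine ⟨fun i hi j hj hij => ?_, fun i hi => ?_⟩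
      · simp only [Set.mem_Icc] at hi hj
        have hx : ∀ i, 1 ≤ i → i ≤ p → x.2.1.1 i ≤ N := fun i h1 h2 =>
          ((x.2.1.2.1 (show i ∈ Set.Icc 1 p from ⟨h1, h2⟩) (show p ∈ Set.Icc 1 p from ⟨hp, le_rfl⟩)
            h2).trans_eq x.2.2).trans (Nat.lt_succ_iff.mp x.1.2)
        by_cases h1 : i = p + 1
        · simp [h1, show j = p + 1 by omega]
        · by_cases h2 : j = p + 1
          · simp only [h1, h2, if_false, if_true]
            exact hx i hi.1 (by omega)
          · simp only [h1, h2, if_false]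
            exact x.2.1.2.1 ⟨hi.1, by omega⟩ ⟨hj.1, by omega⟩ hij
      · simp only [Set.mem_Icc] at hi
        simp only [show i ≠ p + 1 by rintro rfl; omega, if_false]
        refine x.2.1.2.2 i fun h' => hi ?_
        simp only [Set.mem_Icc] at h'
        omega⟩, by simp⟩
  left_inv s := by
    refine Subtype.ext (Subtype.ext (funext fun i => ?_))
    by_cases h : i = p + 1
    · subst h; simpa using s.2.symm
    · simp [h]
  right_inv x := by
    refine sigma_chainEnd_ext (funext fun i => ?_)
    by_cases h : i = p + 1
    · simp only [h, if_true]
      exact (x.2.1.2.2 _ (by simp)).symm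
    · simp [h]

instance chainEnd_finite (p N : ℕ) : Finite (ChainEnd (p + 1) N) := by
  induction p generalizing N with
  | zero => have := chainEndOne N; exact @Finite.of_subsingleton _ this.instSubsingleton
  | succ p ih => exact Finite.of_equiv _ (chainEndSucc (p + 1) N (by omega)).symm

/-- The sum over all chains of length `m + 1` with last entry `N` is a nested sum. -/
lemma finsum_chainEnd {R : Type*} [CommSemiring R] (w : ℕ → ℕ → R) (m N : ℕ) :
    ∑ᶠ s : ChainEnd (m + 1) N, ∏ i ∈ Icc 1 m, w (s.1.1 i) (s.1.1 (i + 1)) =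
      nestedSum w m N := by
  induction m generalizing N with
  | zero =>
    have := chainEndOne N
    simp [nestedSum, finsum_unique]
  | succ m ih =>
    have hfin : ∀ p N, Fintype (ChainEnd (p + 1) N) := fun p N => Fintype.ofFinite _
    rw [← finsum_comp_equiv (chainEndSucc (m + 1) N (by omega)).symm, finsum_eq_sum_of_fintype,
      Fintype.sum_sigma, nestedSum, ← Fin.sum_univ_eq_sum_range
        (fun s => w s N * nestedSum w m s)]
    refine sum_congr rfl fun x _ => ?_
    rw [← ih, finsum_eq_sum_of_fintype, mul_sum]
    refine sum_congr rfl fun s _ => ?_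
    rw [prod_Icc_succ_top (by omega), mul_comm]
    congr 1
    · simp [chainEndSucc, s.2]
    · refine prod_congr rfl fun i hi => ?_
      simp only [mem_Icc] at hi
      simp [chainEndSucc, show i ≠ m + 2 by omega, show i ≠ m + 1 by omega]

lemma tsum_chainEnd (w : ℕ → ℕ → ℂ) (g : ℕ → ℂ) (m N : ℕ) :
    ∑' s : ChainEnd (m + 1) N, g (s.1.1 (m + 1)) * ∏ i ∈ Icc 1 m, w (s.1.1 i) (s.1.1 (i + 1)) =
      g N * nestedSum w m N := by
  have : Fintype (ChainEnd (m + 1) N) := Fintype.ofFinite _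
  rw [tsum_fintype, ← finsum_chainEnd, finsum_eq_sum_of_fintype, mul_sum]
  exact sum_congr rfl fun s _ => by rw [s.2]

/-- Absolute convergence and value of a sum over chains, organised by the last entry. -/
lemma hasSum_chain (w : ℕ → ℕ → ℂ) (g : ℕ → ℂ) (m : ℕ)
    (h : Summable fun N => ‖g N‖ * nestedSum (fun s N => ‖w s N‖) m N) :
    HasSum (fun s : Chain (m + 1) => g (s.1 (m + 1)) * ∏ i ∈ Icc 1 m, w (s.1 i) (s.1 (i + 1)))
      (∑' N, g N * nestedSum w m N) := by
  set F : Chain (m + 1) → ℂ :=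
    fun s => g (s.1 (m + 1)) * ∏ i ∈ Icc 1 m, w (s.1 i) (s.1 (i + 1))
  set φ := Equiv.sigmaFiberEquiv fun s : Chain (m + 1) => s.1 (m + 1)
  have hsum : Summable (F ∘ φ) := by
    refine Summable.of_norm ?_
    rw [summable_sigma_of_nonneg fun _ => norm_nonneg _]
    refine ⟨fun N => ?_, h.congr fun N => ?_⟩
    · have : Fintype (ChainEnd (m + 1) N) := Fintype.ofFinite _
      exact (hasSum_fintype _).summable
    · have : Fintype (ChainEnd (m + 1) N) := Fintype.ofFinite _
      rw [← finsum_chainEnd, finsum_eq_sum_of_fintype, mul_sum]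
      refine Eq.trans ?_ (tsum_fintype _).symm
      refine sum_congr rfl fun s _ => ?_
      change _ = ‖g (s.1.1 (m + 1)) * _‖
      rw [norm_mul, norm_prod, s.2]
      rfl
  rw [← φ.hasSum_iff]
  convert hsum.hasSum using 1
  rw [hsum.tsum_sigma]
  exact tsum_congr fun N => (tsum_chainEnd w g m N).symm

lemma nestedSum_le {w : ℕ → ℕ → ℝ} (hw : ∀ s N, 0 ≤ w s N) {K : ℝ}
    (hK : ∀ N, ∑ s ∈ range (N + 1), w s N ≤ K) (m N : ℕ) :
    0 ≤ nestedSum w m N ∧ nestedSum w m N ≤ K ^ m := by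
  have hK0 : 0 ≤ K := (sum_nonneg fun s _ => hw s 0).trans (hK 0)
  induction m generalizing N with
  | zero => simp [nestedSum]
  | succ m ih =>
    refine ⟨sum_nonneg fun s _ => mul_nonneg (hw _ _) (ih s).1, ?_⟩
    calc nestedSum w (m + 1) N ≤ ∑ s ∈ range (N + 1), w s N * K ^ m :=
          sum_le_sum fun s _ => mul_le_mul_of_nonneg_left (ih s).2 (hw _ _)
      _ = (∑ s ∈ range (N + 1), w s N) * K ^ m := (sum_mul _ _ _).symm
      _ ≤ K * K ^ m := mul_le_mul_of_nonneg_right (hK N) (by positivity)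
      _ = K ^ (m + 1) := (pow_succ' K m).symm

lemma exists_stepWeight_bound {q : ℂ} (hq : ‖q‖ < 1) (e : ℕ) :
    ∃ K : ℝ, ∀ N, ∑ s ∈ range (N + 1), ‖stepWeight q e s N‖ ≤ K := by
  obtain ⟨C, hC, h⟩ := exists_qChoose_bound hq
  have hg := (summable_geometric_of_lt_one (norm_nonneg _) hq).mul_right C
  refine ⟨∑' s : ℕ, ‖q‖ ^ s * C, fun N => ?_⟩
  refine le_trans (sum_le_sum fun s hs => ?_)
    (hg.sum_le_tsum (range (N + 1)) fun s _ => by positivity)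
  have hs' : s ≤ N := Nat.lt_succ_iff.mp (mem_range.mp hs)
  have hb : qBinom q N s = qChoose q s (N - s) := by
    rw [qChoose, Nat.add_sub_cancel' hs']; rfl
  rw [stepWeight, hb, norm_mul, norm_pow]
  exact mul_le_mul (pow_le_pow_of_le_one (norm_nonneg _) hq.le (by nlinarith [Nat.zero_le (e * s)]))
    (h _ _) (norm_nonneg _) (by positivity)

/-! ### The Bailey transform of a Habiro-type series -/

/-- The Bailey transform: exchanging the sums over `n ≤ N`. -/
lemma bailey_transform {q : ℂ} (hq : ‖q‖ < 1) (e : ℕ) (a δ : ℕ → ℂ) {A D : ℝ}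
    (ha : ∀ n, ‖a n‖ ≤ A) (hδ : ∀ N, ‖δ N‖ ≤ D * ‖q‖ ^ N) :
    ∑' N, δ N * ∑ n ∈ range (N + 1), a n * baileyKernel q e N n =
      ∑' n, a n * ∑' j, δ (n + j) * (qFac q j * qFac q (j + (2 * n + e)))⁻¹ := by
  obtain ⟨C, hC1, hC⟩ := exists_qFac_bound hq
  have hC0 : 0 ≤ C := by linarith
  have hA0 : 0 ≤ A := (norm_nonneg _).trans (ha 0)
  set F : ℕ × ℕ → ℂ := fun x =>
    a x.1 * (δ (x.1 + x.2) * (qFac q x.2 * qFac q (x.2 + (2 * x.1 + e)))⁻¹)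
  have hg := summable_geometric_of_lt_one (norm_nonneg _) hq
  have hgg : Summable fun x : ℕ × ℕ => A * (D * (C * C)) * (‖q‖ ^ x.1 * ‖q‖ ^ x.2) :=
    (hg.mul_of_nonneg hg (fun _ => by positivity) fun _ => by positivity).mul_left _
  have hF : Summable F := by
    refine Summable.of_norm_bounded hgg fun x => ?_
    simp only [F, norm_mul, mul_inv]
    have h1 := ha x.1
    have h2 := hδ (x.1 + x.2)
    have h3 := (hC x.2).2
    have h4 := (hC (x.2 + (2 * x.1 + e))).2
    calc _ ≤ A * ((D * ‖q‖ ^ (x.1 + x.2)) * (C * C)) := by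
          refine mul_le_mul h1 (mul_le_mul h2 (mul_le_mul h3 h4 (norm_nonneg _) hC0)
            (by positivity) ((norm_nonneg _).trans h2)) (by positivity) hA0
      _ = _ := by rw [pow_add]; ring
  have hrow : ∀ n, ∑' j, F (n, j) =
      a n * ∑' j, δ (n + j) * (qFac q j * qFac q (j + (2 * n + e)))⁻¹ :=
    fun n => by simp only [F]; exact tsum_mul_left
  rw [← tsum_congr hrow, ← hF.tsum_prod]
  let σ : (Σ N : ℕ, antidiagonal N) ≃ ℕ × ℕ := HasAntidiagonal.sigmaAntidiagonalEquivProd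
  have hσ := σ.summable_iff.mpr hF
  rw [← σ.tsum_eq F]
  refine Eq.trans ?_ hσ.tsum_sigma.symm
  refine tsum_congr fun N => ?_
  rw [tsum_fintype]
  refine Eq.trans ?_ (sum_coe_sort (antidiagonal N) F).symm
  rw [Nat.sum_antidiagonal_eq_sum_range_succ_mk, mul_sum]
  refine sum_congr rfl fun n hn => ?_
  have hn' : n ≤ N := Nat.lt_succ_iff.mp (mem_range.mp hn)
  simp only [F, baileyKernel, Nat.add_sub_cancel' hn',
    show N - n + (2 * n + e) = N + n + e by omega]
  ring

/-- A Habiro-type sum over chains of length `m + 1` with weight `δ` at the last entry, evaluated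
through the Bailey chain and the Bailey transform. -/
lemma hasSum_chain_bailey {q : ℂ} (hq : ‖q‖ < 1) (e m : ℕ) (a δ g : ℕ → ℂ) {A D : ℝ}
    (hunit : ∀ N, ∑ n ∈ range (N + 1), a n * baileyKernel q e N n = if N = 0 then 1 else 0)
    (ha : ∀ n, ‖a n‖ ≤ A) (hδ : ∀ N, ‖δ N‖ ≤ D * ‖q‖ ^ N)
    (hg : ∀ N, g N = δ N * (qFac q N)⁻¹) :
    HasSum (fun s : Chain (m + 1) => g (s.1 (m + 1)) *
        ∏ i ∈ Icc 1 m, stepWeight q e (s.1 i) (s.1 (i + 1)))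
      (∑' n, a n * q ^ ((m + 1) * (n ^ 2 + e * n)) *
        ∑' j, δ (n + j) * (qFac q j * qFac q (j + (2 * n + e)))⁻¹) := by
  obtain ⟨C, hC1, hC⟩ := exists_qFac_bound hq
  have hC0 : 0 ≤ C := by linarith
  obtain ⟨K, hK⟩ := exists_stepWeight_bound hq e
  have hw := fun N => nestedSum_le (w := fun s N => ‖stepWeight q e s N‖)
    (fun _ _ => norm_nonneg _) hK m N
  have hgeo := summable_geometric_of_lt_one (norm_nonneg _) hq
  have hsum : Summable fun N => ‖g N‖ * nestedSum (fun s N => ‖stepWeight q e s N‖) m N := by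
    refine Summable.of_nonneg_of_le (fun N => mul_nonneg (norm_nonneg _) (hw N).1) (fun N => ?_)
      (hgeo.mul_left (D * C * K ^ m))
    calc _ ≤ (D * ‖q‖ ^ N * C) * K ^ m := by
          refine mul_le_mul ?_ (hw N).2 (hw N).1
            (mul_nonneg ((norm_nonneg _).trans (hδ N)) hC0)
          rw [hg, norm_mul]
          exact mul_le_mul (hδ N) (hC N).2 (norm_nonneg _) ((norm_nonneg _).trans (hδ N))
      _ = _ := by ring
  have h := hasSum_chain (stepWeight q e) g m hsum
  convert h using 1
  have ha' : ∀ n, ‖a n * q ^ ((m + 1) * (n ^ 2 + e * n))‖ ≤ A := fun n => by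
    rw [norm_mul, norm_pow]
    exact (mul_le_of_le_one_right (norm_nonneg _) (pow_le_one₀ (norm_nonneg _) hq.le)).trans (ha n)
  rw [← bailey_transform hq e _ δ ha' hδ]
  refine tsum_congr fun N => ?_
  rw [← nestedSum_eq hq e a hunit, hg]
  ring

lemma norm_unitCoeffOdd_le {q : ℂ} (hq : ‖q‖ < 1) (n : ℕ) : ‖unitCoeffOdd q n‖ ≤ 2 := by
  have h : ∀ k, ‖q‖ ^ k ≤ 1 := fun k => pow_le_one₀ (norm_nonneg _) hq.le
  rw [unitCoeffOdd, norm_mul, norm_mul, norm_pow, norm_neg, norm_one, one_pow, one_mul, norm_pow]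
  have h2 : ‖1 - q ^ (2 * n + 1)‖ ≤ 2 := (norm_sub_le _ _).trans (by
    rw [norm_one, norm_pow]; linarith [h (2 * n + 1)])
  exact (mul_le_mul (h _) h2 (norm_nonneg _) zero_le_one).trans (by norm_num)

lemma norm_unitCoeffEven_le {q : ℂ} (hq : ‖q‖ < 1) (n : ℕ) : ‖unitCoeffEven q n‖ ≤ 2 := by
  have h : ∀ k, ‖q‖ ^ k ≤ 1 := fun k => pow_le_one₀ (norm_nonneg _) hq.le
  refine (norm_add_le _ _).trans ?_
  rw [show (2 : ℝ) = 1 + 1 by norm_num]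
  refine add_le_add ?_ ?_
  · simpa using h (n.choose 2 + n)
  · split_ifs
    · simp
    · simpa using h (n.choose 2)

/-! ### The conjugate Bailey pairs -/

/-- The kernel relative to `a = q` is a difference of two kernels relative to `a = 1`. -/
lemma tsum_kernelOdd {q : ℂ} (hq : ‖q‖ < 1) (c m : ℕ) (hc : 1 ≤ c) :
    (1 - q ^ (m + 1)) * ∑' j : ℕ, q ^ (c * j) *
        (qFac q (2 * j + m) * (qFac q j * qFac q (j + (m + 1)))⁻¹) =
      ∑' j : ℕ, q ^ (c * j) * qChoose q j (j + m) -
        q ^ (m + 1 + c) * ∑' j : ℕ, q ^ (c * j) * qChoose q j (j + (m + 2)) := by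
  have hS := one_sub_pow_ne_zero hq
  have hF := qFac_ne_zero hq
  have h1 := summable_pow_mul_qChoose hq 0 m (c * ·) fun j => Nat.le_mul_of_pos_left j hc
  have h2 := summable_pow_mul_qChoose hq 0 (m + 2) (c * ·) fun j => Nat.le_mul_of_pos_left j hc
  simp only [add_zero] at h1 h2
  rw [← tsum_mul_left]
  set f : ℕ → ℂ := fun j => (1 - q ^ (m + 1)) * (q ^ (c * j) *
        (qFac q (2 * j + m) * (qFac q j * qFac q (j + (m + 1)))⁻¹))
  have hsucc : ∀ j, f (j + 1) = q ^ (c * (j + 1)) * qChoose q (j + 1) (j + 1 + m) -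
      q ^ (m + 1 + c) * (q ^ (c * j) * qChoose q j (j + (m + 2))) := fun j => by
    have a1 := hF j
    have a2 := hF (j + 1 + m)
    have a3 := hS j
    have a4 := hS (j + 1 + m)
    simp only [f, qChoose, show j + 1 + (m + 1) = j + 1 + m + 1 by ring,
      show j + (m + 2) = j + 1 + m + 1 by ring, show 2 * (j + 1) + m = j + 1 + (j + 1 + m) by ring,
      show j + (j + 1 + m + 1) = j + 1 + (j + 1 + m) by ring, qFac_succ q j,
      qFac_succ q (j + 1 + m)]
    field_simp
    ring
  have h3 : Summable fun j : ℕ => q ^ (c * (j + 1)) * qChoose q (j + 1) (j + 1 + m) :=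
    (summable_nat_add_iff 1).mpr h1
  have hfs : Summable fun j => f (j + 1) :=
    (h3.sub (h2.mul_left (q ^ (m + 1 + c)))).congr fun j => (hsucc j).symm
  rw [((summable_nat_add_iff 1).mp hfs).tsum_eq_zero_add, tsum_congr hsucc,
    h3.tsum_sub (h2.mul_left _), tsum_mul_left, h1.tsum_eq_zero_add, add_sub_assoc]
  congr 1
  have a1 := hF m
  have a2 := hS m
  simp only [f, qChoose_zero_left hq, mul_zero, pow_zero, zero_add, qFac_zero, qFac_succ]
  field_simp

/-- The conjugate Bailey pair relative to `a = q` with `δ_N = q^N (q)_{2N+1}`. -/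
lemma conjugate_odd_fac_succ {q : ℂ} (hq : ‖q‖ < 1) (n : ℕ) :
    ∑' j : ℕ, q ^ (n + j) * qFac q (2 * (n + j) + 1) *
        (qFac q j * qFac q (j + (2 * n + 1)))⁻¹ = q ^ n * centralSum q (2 * n + 2) := by
  rw [show 2 * n + 2 = 2 * n + 1 + 1 by ring, centralSum_succ hq, ← tsum_mul_left]
  refine tsum_congr fun j => ?_
  rw [qChoose, show 2 * (n + j) + 1 = j + (j + (2 * n + 1)) by ring]
  ring

/-- The conjugate Bailey pair relative to `a = q` with `δ_N = q^N (q)_{2N}`. -/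
lemma conjugate_odd_fac {q : ℂ} (hq : ‖q‖ < 1) (n : ℕ) :
    (1 - q ^ (2 * n + 1)) * ∑' j : ℕ, q ^ (n + j) * qFac q (2 * (n + j)) *
        (qFac q j * qFac q (j + (2 * n + 1)))⁻¹ =
      q ^ n * (centralSum q (2 * n + 1) - q ^ (2 * n + 2) * centralSum q (2 * n + 3)) := by
  have h := tsum_kernelOdd hq 1 (2 * n) le_rfl
  simp only [one_mul] at h
  rw [show 2 * n + 3 = 2 * n + 2 + 1 by ring, centralSum_succ hq, centralSum_succ hq, ← h,
    mul_left_comm]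
  congr 1
  rw [← tsum_mul_left]
  refine tsum_congr fun j => ?_
  rw [show 2 * (n + j) = 2 * j + 2 * n by ring]
  ring

/-- The conjugate Bailey pair relative to `a = q` with `δ_N = q^{2N} (q)_{2N}`. -/
lemma conjugate_odd_sq {q : ℂ} (hq : ‖q‖ < 1) (n : ℕ) :
    (1 - q ^ (2 * n + 1)) * ∑' j : ℕ, q ^ (2 * (n + j)) * qFac q (2 * (n + j)) *
        (qFac q j * qFac q (j + (2 * n + 1)))⁻¹ =
      q ^ (2 * n) * (centralSum q (2 * n + 1) - q * centralSum q (2 * n + 3)) := by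
  have h := tsum_kernelOdd hq 2 (2 * n) one_le_two
  rw [show 2 * n + 1 + 2 = 2 * n + 3 by ring, tsum_sq_qChoose' hq, tsum_sq_qChoose hq] at h
  rw [show centralSum q (2 * n + 1) - q * centralSum q (2 * n + 3) =
    centralSum q (2 * n + 2) - q * centralSum q (2 * n + 3) -
      (centralSum q (2 * n + 2) - centralSum q (2 * n + 1)) by ring, ← h, mul_left_comm]
  congr 1
  rw [← tsum_mul_left]
  refine tsum_congr fun j => ?_
  rw [show 2 * (n + j) = 2 * j + 2 * n by ring, pow_add]
  ring

/-- The conjugate Bailey pair relative to `a = 1` with `δ_N = q^N (q)_{2N}`. -/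
lemma conjugate_even_fac {q : ℂ} (hq : ‖q‖ < 1) (n : ℕ) :
    ∑' j : ℕ, q ^ (n + j) * qFac q (2 * (n + j)) *
        (qFac q j * qFac q (j + (2 * n + 0)))⁻¹ = q ^ n * centralSum q (2 * n + 1) := by
  rw [centralSum_succ hq, ← tsum_mul_left]
  refine tsum_congr fun j => ?_
  rw [qChoose, add_zero, show 2 * (n + j) = j + (j + 2 * n) by ring]
  ring

/-- The sequence `δ_N = q^N (q)_{2N} / (1 + q^N)`, but with `δ_0 = 1` instead of `1 / 2`: this is
`q^N (q^N)_N (q)_N`, where `(q^N)_N` is the empty product for `N = 0`. -/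
noncomputable def halfDelta (q : ℂ) (N : ℕ) : ℂ :=
  if N = 0 then 1 else q ^ N * (qFac q (2 * N) / (1 + q ^ N))

lemma one_sub_pow_two_mul (q : ℂ) (N : ℕ) :
    1 - q ^ (2 * N) = (1 - q ^ N) * (1 + q ^ N) := by ring

/-- The conjugate Bailey pair relative to `a = 1` with `δ = halfDelta`, for `n = 0`. -/
lemma conjugate_even_half_zero {q : ℂ} (hq : ‖q‖ < 1) :
    ∑' j : ℕ, halfDelta q (0 + j) * (qFac q j * qFac q (j + (2 * 0 + 0)))⁻¹ =
      centralSum q 0 := by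
  have hS := one_sub_pow_ne_zero hq
  have hP := one_add_pow_ne_zero hq
  have hF := qFac_ne_zero hq
  set f : ℕ → ℂ := fun j => halfDelta q (0 + j) * (qFac q j * qFac q (j + (2 * 0 + 0)))⁻¹
  have hsucc : ∀ j, f (j + 1) = q ^ (j + 1) * qChoose q (j + 1) (j + 0) := fun j => by
    have a1 := hF j
    have a2 := hS j
    have a3 := hP j
    have e1 : qFac q (2 * (j + 1)) = qFac q (j + 1 + j) * ((1 - q ^ (j + 1)) * (1 + q ^ (j + 1))) := by
      rw [← one_sub_pow_two_mul, show 2 * (j + 1) = j + 1 + j + 1 by ring, qFac_succ]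
    simp only [f, halfDelta, qChoose, zero_add, add_zero, mul_zero, Nat.succ_ne_zero, if_false, e1,
      qFac_succ q j]
    field_simp
  have hs : Summable fun j => f (j + 1) :=
    (summable_pow_mul_qChoose hq 1 0 (· + 1) fun j => Nat.le_succ j).congr fun j => (hsucc j).symm
  rw [((summable_nat_add_iff 1).mp hs).tsum_eq_zero_add, tsum_congr hsucc, centralSum]
  simp [f, halfDelta]

/-- The conjugate Bailey pair relative to `a = 1` with `δ = halfDelta`, for indices `n + 1`. -/
lemma conjugate_even_half_succ {q : ℂ} (hq : ‖q‖ < 1) (n : ℕ) :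
    (1 + q ^ (n + 1)) * ∑' j : ℕ, halfDelta q (n + 1 + j) *
        (qFac q j * qFac q (j + (2 * (n + 1) + 0)))⁻¹ =
      q ^ (n + 1) * centralSum q (2 * (n + 1)) +
        q ^ (2 * (n + 1) + 1) * centralSum q (2 * (n + 1) + 2) := by
  have hS := one_sub_pow_ne_zero hq
  have hP := one_add_pow_ne_zero hq
  have hF := qFac_ne_zero hq
  rw [show 2 * (n + 1) = 2 * n + 1 + 1 by ring, centralSum_succ hq,
    show 2 * n + 1 + 1 + 2 = 2 * n + 3 + 1 by ring, centralSum_succ hq]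
  have h1 := summable_pow_mul_qChoose hq 0 (2 * n + 1) id fun _ => le_rfl
  have h2 := summable_pow_mul_qChoose hq 0 (2 * n + 3) id fun _ => le_rfl
  simp only [add_zero, id] at h1 h2
  have h3 : Summable fun j : ℕ => q ^ (j + 1) * qChoose q (j + 1) (j + 1 + (2 * n + 1)) :=
    (summable_nat_add_iff 1).mpr h1
  rw [← tsum_mul_left]
  set f : ℕ → ℂ := fun j => (1 + q ^ (n + 1)) * (halfDelta q (n + 1 + j) *
        (qFac q j * qFac q (j + (2 * n + 1 + 1 + 0)))⁻¹)
  have hfac : ∀ j, halfDelta q (n + 1 + j) =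
      q ^ (n + 1 + j) * (qFac q (2 * j + 2 * n + 1) * (1 - q ^ (n + j + 1))) := fun j => by
    have a3 := hP (n + j)
    rw [halfDelta, if_neg (by omega), show 2 * (n + 1 + j) = 2 * j + 2 * n + 1 + 1 by ring,
      qFac_succ, show 2 * j + 2 * n + 1 + 1 = 2 * (n + j + 1) by ring, one_sub_pow_two_mul,
      show n + 1 + j = n + j + 1 by ring]
    field_simp
  have hsucc : ∀ j, f (j + 1) =
      q ^ (n + 1) * (q ^ (j + 1) * qChoose q (j + 1) (j + 1 + (2 * n + 1))) +
      q ^ (2 * n + 1 + 1 + 1) * (q ^ j * qChoose q j (j + (2 * n + 3))) := fun j => by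
    have a1 := hF j
    have a2 := hF (j + 1 + (2 * n + 1))
    have a3 := hS j
    have a4 := hS (j + 1 + (2 * n + 1))
    simp only [f, hfac, qChoose, show j + 1 + (2 * n + 1 + 1 + 0) = j + 1 + (2 * n + 1) + 1 by ring,
      show j + (2 * n + 3) = j + 1 + (2 * n + 1) + 1 by ring,
      show 2 * (j + 1) + 2 * n + 1 = j + 1 + (j + 1 + (2 * n + 1)) by ring,
      show j + (j + 1 + (2 * n + 1) + 1) = j + 1 + (j + 1 + (2 * n + 1)) by ring, qFac_succ q j,
      qFac_succ q (j + 1 + (2 * n + 1))]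
    field_simp
    ring
  have hfs : Summable fun j => f (j + 1) :=
    ((h3.mul_left _).add (h2.mul_left _)).congr fun j => (hsucc j).symm
  rw [((summable_nat_add_iff 1).mp hfs).tsum_eq_zero_add, tsum_congr hsucc,
    (h3.mul_left _).tsum_add (h2.mul_left _), tsum_mul_left, tsum_mul_left, h1.tsum_eq_zero_add]
  have h0 : f 0 = q ^ (n + 1) := by
    have a1 := hF (2 * n + 1)
    have a2 := hS (2 * n + 1)
    simp only [f, hfac, mul_zero, zero_add, add_zero, qFac_zero, qFac_succ q (2 * n + 1)]
    rw [show q ^ (2 * n + 1 + 1) = q ^ (2 * (n + 1)) by ring, one_sub_pow_two_mul] at a2 ⊢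
    have a3 := left_ne_zero_of_mul a2
    have a4 := right_ne_zero_of_mul a2
    field_simp
  rw [h0]
  simp only [qChoose_zero_left hq, pow_zero, zero_add]
  ring

/-! ### The Habiro-type series as double sums -/

/-- The exponent of `q` in the `(n, r)`-th positive term of `(q)_∞ H_p^{(k)}(q)`. -/
def posExp (p k n r : ℕ) : ℕ :=
  match k with
  | 1 => p * (n ^ 2 + n) + n.choose 2 + n + (3 * r.choose 2 + 2 * r + (2 * n + 2) * r)
  | 2 => p * n ^ 2 + n.choose 2 + n + (3 * r.choose 2 + 2 * r + 2 * n * r)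
  | 3 => p * (n ^ 2 + n) + n.choose 2 + 2 * n + (3 * r.choose 2 + 2 * r + (2 * n + 1) * r)
  | 4 => p * (n ^ 2 + n) + n.choose 2 + n + (3 * r.choose 2 + 2 * r + (2 * n + 1) * r)
  | 5 => p * n ^ 2 + n.choose 2 + 2 * n + (3 * r.choose 2 + 2 * r + (2 * n + 1) * r)
  | _ => 0

/-- The exponent of `q` in the `(n, r)`-th negative term of `(q)_∞ H_p^{(k)}(q)`. For `k = 2, 5` it
comes from the coefficient of index `n + 1` of the Bailey pair, as the coefficient of index `0`
contributes to the positive terms only. -/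
def negExp (p k n r : ℕ) : ℕ :=
  match k with
  | 1 => p * (n ^ 2 + n) + n.choose 2 + (3 * n + 1) + (3 * r.choose 2 + 2 * r + (2 * n + 2) * r)
  | 2 => p * (n + 1) ^ 2 + (n + 1).choose 2 + (2 * (n + 1) + 1) +
      (3 * r.choose 2 + 2 * r + (2 * (n + 1) + 2) * r)
  | 3 => p * (n ^ 2 + n) + n.choose 2 + (2 * n + 1) + (3 * r.choose 2 + 2 * r + (2 * n + 3) * r)
  | 4 => p * (n ^ 2 + n) + n.choose 2 + (3 * n + 2) + (3 * r.choose 2 + 2 * r + (2 * n + 3) * r)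
  | 5 => p * (n + 1) ^ 2 + (n + 1).choose 2 + (n + 1) +
      (3 * r.choose 2 + 2 * r + (2 * (n + 1) + 1) * r)
  | _ => 0

lemma tsum_row {q : ℂ} (hq : ‖q‖ < 1) (n K M : ℕ) :
    (qInf q)⁻¹ * ∑' r : ℕ, (-1 : ℂ) ^ (n + r) * q ^ (K + (3 * r.choose 2 + 2 * r + M * r)) =
      (-1) ^ n * q ^ K * centralSum q M := by
  rw [centralSum_eq hq, mul_left_comm _ (qInf q)⁻¹]
  congr 1
  rw [← tsum_mul_left]
  exact tsum_congr fun r => by ring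

lemma tsum_rows {A B : ℕ × ℕ → ℂ} (hA : Summable A) (hB : Summable B) {W : ℕ → ℂ} {c : ℂ}
    (h : ∀ n, W n = c * ∑' r, A (n, r) - c * ∑' r, B (n, r)) :
    ∑' n, W n = c * (∑' x, A x - ∑' x, B x) := by
  rw [tsum_congr h, (hA.prod.mul_left c).tsum_sub (hB.prod.mul_left c), tsum_mul_left,
    tsum_mul_left, ← hA.tsum_prod, ← hB.tsum_prod, mul_sub]

lemma tsum_rows_shift {A B : ℕ × ℕ → ℂ} (hA : Summable A) (hB : Summable B) {W : ℕ → ℂ} {c : ℂ}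
    (h0 : W 0 = c * ∑' r, A (0, r))
    (h : ∀ n, W (n + 1) = c * ∑' r, A (n + 1, r) - c * ∑' r, B (n, r)) :
    ∑' n, W n = c * (∑' x, A x - ∑' x, B x) := by
  have hA' : Summable fun n => c * ∑' r, A (n + 1, r) :=
    (summable_nat_add_iff 1).mpr (hA.prod.mul_left c)
  have hB' := hB.prod.mul_left c
  have hW : Summable W := (summable_nat_add_iff 1).mp ((hA'.sub hB').congr fun n => (h n).symm)
  rw [hW.tsum_eq_zero_add, tsum_congr h, hA'.tsum_sub hB', h0, ← add_sub_assoc,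
    ← (hA.prod.mul_left c).tsum_eq_zero_add, tsum_mul_left,
    tsum_mul_left, ← hA.tsum_prod, ← hB.tsum_prod, mul_sub]

lemma norm_pow_mul_qFac_le {q : ℂ} (hq : ‖q‖ < 1) {C : ℝ} (hC : ∀ n, ‖qFac q n‖ ≤ C)
    {f : ℕ → ℕ} (hf : ∀ N, N ≤ f N) (g : ℕ → ℕ) (N : ℕ) :
    ‖q ^ f N * qFac q (g N)‖ ≤ C * ‖q‖ ^ N := by
  rw [norm_mul, norm_pow, mul_comm]
  exact mul_le_mul (hC _) (pow_le_pow_of_le_one (norm_nonneg _) hq.le (hf N)) (by positivity)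
    ((norm_nonneg _).trans (hC 0))

lemma exists_halfDelta_bound {q : ℂ} (hq : ‖q‖ < 1) :
    ∃ D : ℝ, ∀ N, ‖halfDelta q N‖ ≤ D * ‖q‖ ^ N := by
  obtain ⟨C, hC1, hC⟩ := exists_qFac_bound hq
  have h1 : 0 < 1 - ‖q‖ := by linarith
  have hD : 1 ≤ 1 + C / (1 - ‖q‖) := by
    have : 0 ≤ C / (1 - ‖q‖) := by positivity
    linarith
  refine ⟨1 + C / (1 - ‖q‖), fun N => ?_⟩
  rw [halfDelta]
  split_ifs with hN
  · subst hN; simpa using hD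
  · rw [norm_mul, norm_div, norm_pow, mul_comm]
    gcongr
    have h2 : 1 - ‖q‖ ≤ ‖1 + q ^ N‖ := by
      have h3 := norm_sub_le_norm_add (1 : ℂ) (q ^ N)
      have h4 : ‖q‖ ^ N ≤ ‖q‖ := pow_le_of_le_one (norm_nonneg _) hq.le hN
      rw [norm_one, norm_pow] at h3
      linarith
    exact (div_le_div₀ (by linarith) (hC _).1 h1 h2).trans (by linarith)

lemma pow_mul_qPoch {q : ℂ} (hq : ‖q‖ < 1) (f N m : ℕ) :
    q ^ f * qPoch q (q ^ (N + 1)) m = q ^ f * qFac q (N + m) * (qFac q N)⁻¹ := by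
  have := qFac_ne_zero hq N
  rw [← qPoch_pow_succ]
  field_simp

/-- The series with the inner weights `q^{s_i (s_i + 1)}`, where `a = q` in the Bailey pairs. -/
lemma hasSum_habiroOdd {q : ℂ} (hq : ‖q‖ < 1) (m k : ℕ) {f g : ℕ → ℕ} (hf : ∀ N, N ≤ f N)
    (hterm : ∀ s : ℕ → ℕ, habiroTerm (m + 1) k q s =
      q ^ f (s (m + 1)) * qPoch q (q ^ (s (m + 1) + 1)) (g (s (m + 1))) *
        ∏ i ∈ Icc 1 m, q ^ (s i * (s i + 1)) * qBinom q (s (i + 1)) (s i))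
    {A B : ℕ × ℕ → ℂ} (hA : Summable A) (hB : Summable B)
    (h : ∀ n, unitCoeffOdd q n * q ^ ((m + 1) * (n ^ 2 + n)) *
        ∑' j, q ^ f (n + j) * qFac q (n + j + g (n + j)) *
          (qFac q j * qFac q (j + (2 * n + 1)))⁻¹ =
      (qInf q)⁻¹ * ∑' r, A (n, r) - (qInf q)⁻¹ * ∑' r, B (n, r)) :
    HasSum (fun s : Chain (m + 1) => habiroTerm (m + 1) k q s.1)
      ((qInf q)⁻¹ * (∑' x, A x - ∑' x, B x)) := by
  obtain ⟨C, -, hC⟩ := exists_qFac_bound hq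
  have hs := hasSum_chain_bailey hq 1 m (unitCoeffOdd q)
    (fun N => q ^ f N * qFac q (N + g N)) (fun N => q ^ f N * qPoch q (q ^ (N + 1)) (g N))
    (sum_unitCoeffOdd hq) (norm_unitCoeffOdd_le hq)
    (norm_pow_mul_qFac_le hq (fun n => (hC n).1) hf fun N => N + g N)
    (fun N => pow_mul_qPoch hq _ _ _)
  convert hs using 1
  · funext s
    rw [hterm]
    congr 1
    exact prod_congr rfl fun i _ => by rw [stepWeight]; ring_nf
  · rw [← tsum_rows hA hB h]
    exact tsum_congr fun n => by rw [one_mul]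

lemma unitCoeffOdd_mul (q : ℂ) (n K : ℕ) (S : ℂ) :
    unitCoeffOdd q n * q ^ K * S =
      (-1) ^ n * q ^ (n.choose 2 + K) * ((1 - q ^ (2 * n + 1)) * S) := by
  rw [unitCoeffOdd]; ring

/-- `(q)_∞ H_p^{(k)}(q)` as a difference of two double series. -/
lemma hasSum_habiro {q : ℂ} (hq : ‖q‖ < 1) {p k : ℕ} (hp : 1 ≤ p) (hk : 1 ≤ k) (hk' : k ≤ 5)
    (hA : Summable fun x : ℕ × ℕ => (-1 : ℂ) ^ (x.1 + x.2) * q ^ posExp p k x.1 x.2)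
    (hB : Summable fun x : ℕ × ℕ => (-1 : ℂ) ^ (x.1 + x.2) * q ^ negExp p k x.1 x.2) :
    HasSum (fun s : Chain p => habiroTerm p k q s.1)
      ((qInf q)⁻¹ * (∑' x : ℕ × ℕ, (-1 : ℂ) ^ (x.1 + x.2) * q ^ posExp p k x.1 x.2 -
        ∑' x : ℕ × ℕ, (-1 : ℂ) ^ (x.1 + x.2) * q ^ negExp p k x.1 x.2)) := by
  obtain ⟨m, rfl⟩ := Nat.exists_eq_add_of_le' hp
  obtain ⟨C, -, hC⟩ := exists_qFac_bound hq
  interval_cases k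
  · refine hasSum_habiroOdd hq m 1 (f := id) (g := (· + 1)) (fun _ => le_rfl) (fun s => rfl)
      hA hB fun n => ?_
    have := conjugate_odd_fac_succ hq n
    simp only [id, show ∀ N, N + (N + 1) = 2 * N + 1 from fun N => by ring]
    simp only [this, posExp, negExp, tsum_row hq, unitCoeffOdd]
    ring
  · have hunfold : ∀ N, q ^ N * qPoch q (q ^ N) N = halfDelta q N * (qFac q N)⁻¹ := fun N => by
      rw [halfDelta]
      split_ifs with hN
      · simp [hN, qPoch]
      · obtain ⟨N, rfl⟩ := Nat.exists_eq_succ_of_ne_zero hN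
        have h1 := qFac_ne_zero hq N
        have h2 := one_sub_pow_ne_zero hq N
        have h3 := one_add_pow_ne_zero hq N
        rw [Nat.succ_eq_add_one, pow_mul_qPoch hq,
          show 2 * (N + 1) = (N + (N + 1)) + 1 by ring, qFac_succ q (N + (N + 1)),
          show N + (N + 1) + 1 = 2 * (N + 1) by ring, one_sub_pow_two_mul, qFac_succ q N]
        field_simp
    obtain ⟨D, hD⟩ := exists_halfDelta_bound hq
    have hs := hasSum_chain_bailey hq 0 m (unitCoeffEven q) (halfDelta q)
      (fun N => q ^ N * qPoch q (q ^ N) N) (sum_unitCoeffEven hq) (norm_unitCoeffEven_le hq) hD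
      hunfold
    convert hs using 1
    · funext s
      refine congrArg₂ (· * ·) rfl (prod_congr rfl fun i _ => ?_)
      rw [stepWeight, zero_mul, add_zero]
    · refine (tsum_rows_shift hA hB ?_ fun n => ?_).symm
      · have := conjugate_even_half_zero hq
        simp only [this, posExp, tsum_row hq]
        simp [unitCoeffEven]
      · have := conjugate_even_half_succ hq n
        simp only [posExp, negExp, tsum_row hq]
        rw [unitCoeffEven, if_neg (Nat.succ_ne_zero n)]
        linear_combination ((-1) ^ (n + 1) * q ^ (n + 1).choose 2 *
          q ^ ((m + 1) * ((n + 1) ^ 2 + 0 * (n + 1)))) * this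
  · refine hasSum_habiroOdd hq m 3 (f := (2 * ·)) (g := id) (fun N => by omega) (fun s => rfl)
      hA hB fun n => ?_
    have := conjugate_odd_sq hq n
    simp only [id, show ∀ N, N + N = 2 * N from fun N => by ring]
    simp only [unitCoeffOdd_mul, this, posExp, negExp, tsum_row hq]
    ring
  · refine hasSum_habiroOdd hq m 4 (f := id) (g := id) (fun _ => le_rfl) (fun s => rfl)
      hA hB fun n => ?_
    have := conjugate_odd_fac hq n
    simp only [id, show ∀ N, N + N = 2 * N from fun N => by ring]
    simp only [unitCoeffOdd_mul, this, posExp, negExp, tsum_row hq]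
    ring
  · have hs := hasSum_chain_bailey hq 0 m (unitCoeffEven q) (fun N => q ^ N * qFac q (2 * N))
      (fun N => q ^ N * qPoch q (q ^ (N + 1)) N) (sum_unitCoeffEven hq) (norm_unitCoeffEven_le hq)
      (norm_pow_mul_qFac_le hq (fun n => (hC n).1) (f := id) (fun _ => le_rfl) fun N => 2 * N)
      (fun N => by rw [pow_mul_qPoch hq, two_mul])
    convert hs using 1
    · funext s
      refine congrArg₂ (· * ·) rfl (prod_congr rfl fun i _ => ?_)
      rw [stepWeight, zero_mul, add_zero]
    · refine (tsum_rows_shift hA hB ?_ fun n => ?_).symm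
      · have := conjugate_even_fac hq 0
        simp only [this, posExp, tsum_row hq]
        simp [unitCoeffEven]
      · have := conjugate_even_fac hq (n + 1)
        simp only [this, posExp, negExp, tsum_row hq]
        rw [unitCoeffEven, if_neg (Nat.succ_ne_zero n)]
        ring

/-! ### The false theta functions as sums over a shifted integer lattice -/

lemma qPow_add (τ : UpperHalfPlane) (x y : ℝ) : qPow τ (x + y) = qPow τ x * qPow τ y := by
  rw [qPow, qPow, qPow, ← Complex.exp_add]; push_cast; ring_nf

lemma qPow_ne_zero (τ : UpperHalfPlane) (x : ℝ) : qPow τ x ≠ 0 := Complex.exp_ne_zero _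

lemma qPow_natCast (τ : UpperHalfPlane) (n : ℕ) : qPow τ n = qPow τ 1 ^ n := by
  rw [qPow, qPow, ← Complex.exp_nat_mul]; push_cast; ring_nf

lemma norm_qPow (τ : UpperHalfPlane) (x : ℝ) : ‖qPow τ x‖ = Real.exp (-2 * Real.pi * x * τ.im) := by
  rw [qPow, Complex.norm_exp]
  congr 1
  rw [show 2 * (Real.pi : ℂ) * Complex.I * x * τ = ((2 * Real.pi * x : ℝ) : ℂ) * (τ * Complex.I) by
    push_cast; ring, Complex.re_ofReal_mul, Complex.mul_I_re, UpperHalfPlane.coe_im]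
  ring

lemma norm_qPow_one_lt (τ : UpperHalfPlane) : ‖qPow τ 1‖ < 1 := by
  rw [norm_qPow, Real.exp_lt_one_iff]
  nlinarith [Real.pi_pos, τ.im_pos, mul_pos Real.pi_pos τ.im_pos]

lemma eta_eq (τ : UpperHalfPlane) :
    ModularForm.eta (τ : ℂ) = qPow τ (1 / 24) * qInf (qPow τ 1) := by
  rw [ModularForm.eta, qInf]
  congr 1
  · rw [Function.Periodic.qParam, qPow]; push_cast; ring_nf
  · refine tprod_congr fun n => ?_
    rw [ModularForm.eta_q_eq_pow, qPow]; push_cast; ring_nf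

/-- The quadratic form of `matA p` in coordinates. -/
noncomputable def form (p : ℕ) (x y : ℝ) : ℝ := ((2 * p + 1) * x ^ 2 + 4 * x * y + 3 * y ^ 2) / 2

lemma quad_matA (p : ℕ) (n : Fin 2 → ℝ) : quad (matA p) n = form p (n 0) (n 1) := by
  simp [quad, bilin, matA, form, dotProduct, Matrix.mulVec, Fin.sum_univ_two]
  ring

lemma sign_mul_of_pos {c : ℝ} (hc : 0 < c) (x : ℝ) : Real.sign (c * x) = Real.sign x := by
  rcases lt_trichotomy x 0 with h | h | h
  · rw [Real.sign_of_neg h, Real.sign_of_neg (mul_neg_of_pos_of_neg hc h)]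
  · simp [h]
  · rw [Real.sign_of_pos h, Real.sign_of_pos (mul_pos hc h)]

lemma six_mul_sub_one_pos {p : ℕ} (hp : 1 ≤ p) : 0 < 6 * (p : ℝ) - 1 := by
  have : (1 : ℝ) ≤ p := by exact_mod_cast hp
  linarith

/-- The vector `c₁` is `A`-orthogonal to the second coordinate axis. -/
lemma falseThetaTerm_c₁ {p : ℕ} (hp : 1 ≤ p) (τ : UpperHalfPlane) (n : Fin 2 → ℝ) :
    falseThetaTerm (matA p) (c₁ p) τ n = (Real.sign (n 0) : ℝ) * qPow τ (form p (n 0) (n 1)) := by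
  have hD := six_mul_sub_one_pos hp
  have : bilin (matA p) n (c₁ p) =
      (1 / Real.sqrt (3 * (6 * (p : ℝ) - 1)) * (6 * p - 1)) * n 0 := by
    simp [bilin, matA, c₁, dotProduct, Matrix.mulVec, Fin.sum_univ_two]
    ring
  rw [falseThetaTerm, quad_matA, this, sign_mul_of_pos (by positivity)]

/-- The vector `c₂` is `A`-orthogonal to the first coordinate axis. -/
lemma falseThetaTerm_c₂ {p : ℕ} (hp : 1 ≤ p) (τ : UpperHalfPlane) (n : Fin 2 → ℝ) :
    falseThetaTerm (matA p) (c₂ p) τ n = (Real.sign (n 1) : ℝ) * qPow τ (form p (n 0) (n 1)) := by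
  have hD := six_mul_sub_one_pos hp
  have : bilin (matA p) n (c₂ p) =
      (1 / Real.sqrt ((2 * (p : ℝ) + 1) * (6 * (p : ℝ) - 1)) * (6 * p - 1)) * n 1 := by
    simp [bilin, matA, c₂, dotProduct, Matrix.mulVec, Fin.sum_univ_two]
    ring
  rw [falseThetaTerm, quad_matA, this, sign_mul_of_pos (by positivity)]

/-- The Gaussian sum over a shifted lattice converges, since `form p x y ≥ (x² + y²) / 2`. -/
lemma summable_form {p : ℕ} (hp : 1 ≤ p) (τ : UpperHalfPlane) (μ ν : ℝ) :
    Summable fun z : ℤ × ℤ => ‖qPow τ (form p (z.1 + μ) (z.2 + ν))‖ := by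
  have h := fun a => (HurwitzZeta.hasSum_int_evenKernel a τ.im_pos).summable
  refine Summable.of_nonneg_of_le (fun _ => norm_nonneg _) (fun z => ?_)
    ((h μ).mul_of_nonneg (h ν) (fun _ => (Real.exp_pos _).le) fun _ => (Real.exp_pos _).le)
  rw [norm_qPow, ← Real.exp_add, Real.exp_le_exp]
  have hp' : (1 : ℝ) ≤ p := by exact_mod_cast hp
  have hform : ((z.1 + μ) ^ 2 + (z.2 + ν) ^ 2) / 2 ≤ form p (z.1 + μ) (z.2 + ν) := by
    rw [form]
    nlinarith [sq_nonneg ((z.1 + μ : ℝ) + (z.2 + ν)),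
      mul_nonneg (sub_nonneg.mpr hp') (sq_nonneg (z.1 + μ : ℝ))]
  nlinarith [mul_le_mul_of_nonneg_left hform (mul_pos Real.pi_pos τ.im_pos).le]

/-- The coset `2ℤ² + ν` is parametrised by `ℤ²`. -/
noncomputable def cosetEquiv (ν : Fin 2 → ℝ) :
    ℤ × ℤ ≃ {n : Fin 2 → ℝ // n - ν ∈ lattice} :=
  Equiv.ofBijective (fun z => ⟨ν + ![2 * (z.1 : ℝ), 2 * z.2], by
    rw [add_sub_cancel_left, lattice, AddSubgroup.mem_pi]
    intro i _
    rw [AddSubgroup.mem_zmultiples_iff]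
    fin_cases i
    · exact ⟨z.1, by simp [mul_comm]⟩
    · exact ⟨z.2, by simp [mul_comm]⟩⟩) (by
    constructor
    · intro z w h
      have h' := add_left_cancel (Subtype.mk.inj h)
      have h0 := congrFun h' 0
      have h1 := congrFun h' 1
      simp at h0 h1
      exact Prod.ext h0 h1
    · rintro ⟨n, hn⟩
      rw [lattice, AddSubgroup.mem_pi] at hn
      obtain ⟨a, ha⟩ := AddSubgroup.mem_zmultiples_iff.mp (hn 0 (Set.mem_univ _))
      obtain ⟨b, hb⟩ := AddSubgroup.mem_zmultiples_iff.mp (hn 1 (Set.mem_univ _))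
      simp at ha hb
      refine ⟨(a, b), Subtype.ext (funext fun i => ?_)⟩
      fin_cases i
      · simp; linarith
      · simp; linarith)

/-- Splitting `ℤ²` into its classes modulo `2`. -/
noncomputable def parityEquiv : (Fin 2 → Fin 2) × (ℤ × ℤ) ≃ ℤ × ℤ :=
  Equiv.ofBijective
    (fun x => (2 * x.2.1 + ((x.1 0 : ℕ) : ℤ), 2 * x.2.2 + ((x.1 1 : ℕ) : ℤ))) (by
    constructor
    · rintro ⟨ε, a, b⟩ ⟨ε', a', b'⟩ h
      simp only [Prod.mk.injEq] at h
      have h1 := (ε 0).2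
      have h2 := (ε 1).2
      have h3 := (ε' 0).2
      have h4 := (ε' 1).2
      obtain rfl : a = a' := by omega
      obtain rfl : b = b' := by omega
      obtain rfl : ε = ε' := by
        funext i
        fin_cases i
        · exact Fin.ext (by simp; omega)
        · exact Fin.ext (by simp; omega)
      rfl
    · rintro ⟨a, b⟩
      refine ⟨(![⟨(a % 2).toNat, by omega⟩, ⟨(b % 2).toNat, by omega⟩], (a / 2, b / 2)), ?_⟩
      simp
      omega)

lemma cosetEquiv_apply (ν : Fin 2 → ℝ) (z : ℤ × ℤ) :
    (cosetEquiv ν z).1 = ν + ![2 * (z.1 : ℝ), 2 * z.2] := rfl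

lemma parityEquiv_apply (ε : Fin 2 → Fin 2) (z : ℤ × ℤ) :
    parityEquiv (ε, z) = (2 * z.1 + ((ε 0 : ℕ) : ℤ), 2 * z.2 + ((ε 1 : ℕ) : ℤ)) := rfl

/-- The upper right quadrant of `ℤ²` with corner `(a, b)` and the lower left quadrant with corner
`(a - 1, b - 1)`. -/
def quadrants (a b : ℕ) : ℕ × ℕ ⊕ ℕ × ℕ → ℤ × ℤ :=
  Sum.elim (fun x => (a + x.1, b + x.2)) (fun x => (a - 1 - x.1, b - 1 - x.2))

lemma quadrants_injective (a b : ℕ) : Function.Injective (quadrants a b) := by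
  rintro (⟨x, y⟩ | ⟨x, y⟩) (⟨x', y'⟩ | ⟨x', y'⟩) h <;>
  · simp only [quadrants, Sum.elim_inl, Sum.elim_inr, Prod.mk.injEq] at h
    simp only [Sum.inl.injEq, Sum.inr.injEq, Prod.mk.injEq, reduceCtorEq]
    omega

lemma mem_range_quadrants {a b : ℕ} {z : ℤ × ℤ} (h : (a : ℤ) ≤ z.1 ↔ (b : ℤ) ≤ z.2) :
    z ∈ Set.range (quadrants a b) := by
  by_cases h1 : (a : ℤ) ≤ z.1
  · have h2 := h.mp h1
    refine ⟨Sum.inl ((z.1 - a).toNat, (z.2 - b).toNat), Prod.ext ?_ ?_⟩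
    · change (a : ℤ) + ((z.1 - a).toNat : ℤ) = z.1
      omega
    · change (b : ℤ) + ((z.2 - b).toNat : ℤ) = z.2
      omega
  · have h2 : ¬ (b : ℤ) ≤ z.2 := fun h' => h1 (h.mpr h')
    refine ⟨Sum.inr ((a - 1 - z.1).toNat, (b - 1 - z.2).toNat), Prod.ext ?_ ?_⟩
    · change (a : ℤ) - 1 - ((a - 1 - z.1).toNat : ℤ) = z.1
      omega
    · change (b : ℤ) - 1 - ((b - 1 - z.2).toNat : ℤ) = z.2
      omega

lemma hasSum_quadrants {F : ℤ × ℤ → ℂ} {S : ℂ} (hF : HasSum F S) {a b : ℕ}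
    (hsupp : Function.support F ⊆ Set.range (quadrants a b)) {f g : ℕ × ℕ → ℂ}
    (hf : ∀ x, F (quadrants a b (Sum.inl x)) = 2 * f x)
    (hg : ∀ x, F (quadrants a b (Sum.inr x)) = -2 * g x) :
    Summable f ∧ Summable g ∧ S = 2 * (∑' x, f x - ∑' x, g x) := by
  set G : ℕ × ℕ ⊕ ℕ × ℕ → ℂ := fun x => F (quadrants a b x)
  have hG : HasSum G S := ((quadrants_injective a b).hasSum_iff
    fun z hz => by_contra fun h => hz (hsupp h)).mpr hF
  have h1 : Summable fun x => 2 * f x :=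
    (hG.summable.comp_injective Sum.inl_injective).congr hf
  have h2 : Summable fun x => -2 * g x :=
    (hG.summable.comp_injective Sum.inr_injective).congr hg
  have e1 : HasSum (G ∘ Sum.inl) (∑' x, 2 * f x) := by
    rw [show G ∘ Sum.inl = fun x => 2 * f x from funext hf]; exact h1.hasSum
  have e2 : HasSum (G ∘ Sum.inr) (∑' x, -2 * g x) := by
    rw [show G ∘ Sum.inr = fun x => -2 * g x from funext hg]; exact h2.hasSum
  refine ⟨(summable_mul_left_iff two_ne_zero).mp h1,
    (summable_mul_left_iff (neg_ne_zero.mpr two_ne_zero)).mp h2, ?_⟩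
  rw [hG.unique (e1.sum e2), tsum_mul_left, tsum_mul_left]
  ring

lemma sign_int_add {a : ℤ} {μ : ℝ} (h0 : 0 < a + μ) (h1 : a + μ < 1) (z : ℤ) :
    Real.sign (z + μ) = if a ≤ z then 1 else -1 := by
  split_ifs with h
  · have : (a : ℝ) ≤ z := by exact_mod_cast h
    exact Real.sign_of_pos (by linarith)
  · have : (z : ℝ) + 1 ≤ a := by exact_mod_cast not_le.mp h
    exact Real.sign_of_neg (by linarith)

lemma summable_falseThetaTerm {p : ℕ} (hp : 1 ≤ p) (τ : UpperHalfPlane) (ν : Fin 2 → ℝ)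
    {c : Fin 2 → ℝ} (hc : c ∈ ({c₁ p, c₂ p} : Set (Fin 2 → ℝ))) :
    Summable fun z : ℤ × ℤ => falseThetaTerm (matA p) c τ (ν + ![(z.1 : ℝ), z.2]) := by
  have hsign : ∀ x : ℝ, ‖((Real.sign x : ℝ) : ℂ)‖ ≤ 1 := fun x => by
    rcases Real.sign_apply_eq x with h | h | h <;> simp [h]
  refine Summable.of_norm_bounded (summable_form hp τ (ν 0) (ν 1)) fun z => ?_
  rcases hc with rfl | rfl
  · rw [falseThetaTerm_c₁ hp, norm_mul]
    refine (mul_le_of_le_one_left (norm_nonneg _) (hsign _)).trans_eq ?_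
    simp [add_comm]
  · rw [falseThetaTerm_c₂ hp, norm_mul]
    refine (mul_le_of_le_one_left (norm_nonneg _) (hsign _)).trans_eq ?_
    simp [add_comm]

lemma coset_eq_parity (μ : Fin 2 → ℝ) (ε : Fin 2 → Fin 2) (z : ℤ × ℤ) :
    (cosetEquiv (μ + epsVec ε) z).1 =
      μ + ![((parityEquiv (ε, z)).1 : ℝ), ((parityEquiv (ε, z)).2 : ℝ)] := by
  rw [cosetEquiv_apply, parityEquiv_apply]
  funext i
  fin_cases i
  · simp [epsVec]; ring
  · simp [epsVec]; ring

lemma summable_falseTheta {p : ℕ} (hp : 1 ≤ p) (τ : UpperHalfPlane) (μ : Fin 2 → ℝ)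
    (ε : Fin 2 → Fin 2) {c : Fin 2 → ℝ} (hc : c ∈ ({c₁ p, c₂ p} : Set (Fin 2 → ℝ))) :
    Summable fun n : {n : Fin 2 → ℝ // n - (μ + epsVec ε) ∈ lattice} =>
      falseThetaTerm (matA p) c τ n.1 := by
  rw [← (cosetEquiv _).summable_iff]
  refine (((summable_falseThetaTerm hp τ μ hc).comp_injective parityEquiv.injective).comp_injective
    (Prod.mk_right_injective ε)).congr fun z => ?_
  simp only [Function.comp, coset_eq_parity]

/-- The alternating sum over the four cosets is a single sum over `ℤ²`. -/
lemma sum_falseTheta {p : ℕ} (hp : 1 ≤ p) (τ : UpperHalfPlane) (μ : Fin 2 → ℝ)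
    {c : Fin 2 → ℝ} (hc : c ∈ ({c₁ p, c₂ p} : Set (Fin 2 → ℝ))) :
    HasSum (fun z : ℤ × ℤ =>
        (-1 : ℂ) ^ (z.1 + z.2) * falseThetaTerm (matA p) c τ (μ + ![(z.1 : ℝ), z.2]))
      (∑ ε : Fin 2 → Fin 2, (-1 : ℂ) ^ ((ε 0 : ℕ) + (ε 1 : ℕ)) *
        falseTheta (matA p) lattice (μ + epsVec ε) c τ) := by
  set F : ℤ × ℤ → ℂ := fun z =>
    (-1 : ℂ) ^ (z.1 + z.2) * falseThetaTerm (matA p) c τ (μ + ![(z.1 : ℝ), z.2])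
  have hF : Summable F := by
    refine Summable.of_norm ((summable_falseThetaTerm hp τ μ hc).norm.congr fun z => ?_)
    simp [F]
  have hF' : Summable (F ∘ parityEquiv) := parityEquiv.summable_iff.mpr hF
  convert hF.hasSum using 1
  rw [← parityEquiv.tsum_eq F]
  refine Eq.trans ?_ hF'.tsum_prod.symm
  rw [tsum_fintype]
  refine sum_congr rfl fun ε _ => ?_
  rw [falseTheta, ← (cosetEquiv _).tsum_eq, ← tsum_mul_left]
  refine tsum_congr fun z => ?_
  simp only [Function.comp, F, coset_eq_parity]
  congr 1
  simp only [parityEquiv_apply]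
  rw [show 2 * z.1 + ((ε 0 : ℕ) : ℤ) + (2 * z.2 + ((ε 1 : ℕ) : ℤ)) =
    2 * (z.1 + z.2) + (((ε 0 : ℕ) + (ε 1 : ℕ) : ℕ) : ℤ) by push_cast; ring,
    zpow_add₀ (by norm_num), zpow_mul, zpow_natCast]
  simp

/-- If `μ + (a, b)` lies in the open unit square, the sum of the two signs vanishes outside two
opposite quadrants of `ℤ²`. -/
lemma sum_falseTheta_quadrants {p : ℕ} (hp : 1 ≤ p) (τ : UpperHalfPlane) (μ : Fin 2 → ℝ)
    (a b : ℕ) (ha0 : 0 < a + μ 0) (ha1 : a + μ 0 < 1) (hb0 : 0 < b + μ 1) (hb1 : b + μ 1 < 1) :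
    (Summable fun x : ℕ × ℕ => (-1 : ℂ) ^ (a + b + (x.1 + x.2)) *
        qPow τ (form p (a + x.1 + μ 0) (b + x.2 + μ 1))) ∧
    (Summable fun x : ℕ × ℕ => (-1 : ℂ) ^ (a + b + (x.1 + x.2)) *
        qPow τ (form p (a - 1 - x.1 + μ 0) (b - 1 - x.2 + μ 1))) ∧
    ∑ ε : Fin 2 → Fin 2, (-1 : ℂ) ^ ((ε 0 : ℕ) + (ε 1 : ℕ)) *
        (falseTheta (matA p) lattice (μ + epsVec ε) (c₁ p) τ +
          falseTheta (matA p) lattice (μ + epsVec ε) (c₂ p) τ) =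
      2 * (∑' x : ℕ × ℕ, (-1 : ℂ) ^ (a + b + (x.1 + x.2)) *
          qPow τ (form p (a + x.1 + μ 0) (b + x.2 + μ 1)) -
        ∑' x : ℕ × ℕ, (-1 : ℂ) ^ (a + b + (x.1 + x.2)) *
          qPow τ (form p (a - 1 - x.1 + μ 0) (b - 1 - x.2 + μ 1))) := by
  set F : ℤ × ℤ → ℂ := fun z =>
    (-1 : ℂ) ^ (z.1 + z.2) * falseThetaTerm (matA p) (c₁ p) τ (μ + ![(z.1 : ℝ), z.2]) +
    (-1 : ℂ) ^ (z.1 + z.2) * falseThetaTerm (matA p) (c₂ p) τ (μ + ![(z.1 : ℝ), z.2])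
  have hF := (sum_falseTheta hp τ μ (c := c₁ p) (by simp)).add
    (sum_falseTheta hp τ μ (c := c₂ p) (by simp))
  change HasSum F _ at hF
  have hval : ∀ z : ℤ × ℤ, F z = (-1 : ℂ) ^ (z.1 + z.2) *
      (((if (a : ℤ) ≤ z.1 then 1 else -1) + if (b : ℤ) ≤ z.2 then 1 else -1) *
        qPow τ (form p (z.1 + μ 0) (z.2 + μ 1))) := fun z => by
    simp only [F]
    rw [falseThetaTerm_c₁ hp, falseThetaTerm_c₂ hp]
    simp only [Pi.add_apply, Matrix.cons_val_zero, Matrix.cons_val_one, add_comm (μ _)]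
    rw [sign_int_add (a := a) (by exact_mod_cast ha0) (by exact_mod_cast ha1),
      sign_int_add (a := b) (by exact_mod_cast hb0) (by exact_mod_cast hb1)]
    split_ifs <;> push_cast <;> ring
  have hparity : ∀ x : ℕ × ℕ, (-1 : ℂ) ^ ((a : ℤ) - 1 - x.1 + (b - 1 - x.2)) =
      (-1) ^ (a + b + (x.1 + x.2)) := fun x => by
    rw [show (a : ℤ) - 1 - x.1 + (b - 1 - x.2) =
      2 * (-1 - x.1 - x.2) + ((a + b + (x.1 + x.2) : ℕ) : ℤ) by push_cast; ring,
      zpow_add₀ (by norm_num), zpow_mul, zpow_natCast]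
    simp
  have hpp : ∀ x : ℕ × ℕ, F (quadrants a b (Sum.inl x)) = 2 * ((-1 : ℂ) ^ (a + b + (x.1 + x.2)) *
      qPow τ (form p (a + x.1 + μ 0) (b + x.2 + μ 1))) := fun x => by
    rw [hval]
    simp only [quadrants, Sum.elim_inl, show (a : ℤ) ≤ a + x.1 by omega,
      show (b : ℤ) ≤ b + x.2 by omega, if_true]
    rw [show (a : ℤ) + x.1 + (b + x.2) = ((a + b + (x.1 + x.2) : ℕ) : ℤ) by push_cast; ring,
      zpow_natCast]
    push_cast
    ring
  have hmm : ∀ x : ℕ × ℕ, F (quadrants a b (Sum.inr x)) =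
      -2 * ((-1 : ℂ) ^ (a + b + (x.1 + x.2)) *
      qPow τ (form p (a - 1 - x.1 + μ 0) (b - 1 - x.2 + μ 1))) := fun x => by
    rw [hval]
    simp only [quadrants, Sum.elim_inr, show ¬ (a : ℤ) ≤ a - 1 - x.1 by omega,
      show ¬ (b : ℤ) ≤ b - 1 - x.2 by omega, if_false]
    rw [hparity]
    push_cast
    ring
  have hsupp : Function.support F ⊆ Set.range (quadrants a b) := by
    intro z hz
    rw [Function.mem_support, hval] at hz
    refine mem_range_quadrants ?_
    by_contra hne
    refine hz ?_
    by_cases h1 : (a : ℤ) ≤ z.1 <;> by_cases h2 : (b : ℤ) ≤ z.2 <;> simp_all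
  simp_rw [mul_add]
  rw [sum_add_distrib]
  exact hasSum_quadrants hF hsupp hpp hmm

/-! ### Matching the two sides -/

lemma shift_eq {p : ℕ} (hp : 1 ≤ p) {k : ℕ} (hk : 1 ≤ k) (hk' : k ≤ 5) :
    shift p k = (1 / (2 * (6 * (p : ℝ) - 1))) • shiftNum p k := by
  have hD := (six_mul_sub_one_pos hp).ne'
  have hdet : (2 * (p : ℝ) + 1) * 3 - 2 * 2 = 6 * p - 1 := by ring
  have hinv : (matA p)⁻¹ = (6 * (p : ℝ) - 1)⁻¹ • !![3, -2; -2, 2 * (p : ℝ) + 1] := by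
    rw [matA, Matrix.inv_def, Matrix.adjugate_fin_two_of, Matrix.det_fin_two_of,
      Ring.inverse_eq_inv', hdet]
  rw [shift, hinv]
  funext i
  interval_cases k <;> fin_cases i <;>
    simp [intVec, shiftNum] <;> field_simp <;> ring

/-- The double series for `(q)_∞ H_p^{(k)}(q)`, shifted by the exponent `e_k / (24 (6p - 1)) + 1/24`,
which is the value of the quadratic form at `μ_k`; the factor `1 / η` absorbs the shift. -/
lemma hasSum_habiro_of_shifted {p k : ℕ} (hp : 1 ≤ p) (hk : 1 ≤ k) (hk' : k ≤ 5)
    (τ : UpperHalfPlane) {T : ℂ} {f g : ℕ × ℕ → ℂ}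
    (h : Summable f ∧ Summable g ∧ T = 2 * (∑' x, f x - ∑' x, g x))
    (hf : ∀ x, f x = (-1) ^ (x.1 + x.2) *
      qPow τ (posExp p k x.1 x.2 + (expo p k / (24 * (6 * (p : ℝ) - 1)) + 1 / 24)))
    (hg : ∀ x, g x = (-1) ^ (x.1 + x.2) *
      qPow τ (negExp p k x.1 x.2 + (expo p k / (24 * (6 * (p : ℝ) - 1)) + 1 / 24))) :
    HasSum (fun s : Chain p => habiroTerm p k (qPow τ 1) s.1)
      (qPow τ (-(expo p k / (24 * (6 * (p : ℝ) - 1)))) / (2 * ModularForm.eta (τ : ℂ)) * T) := by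
  obtain ⟨hfs, hgs, hT⟩ := h
  have hq := norm_qPow_one_lt τ
  set e : ℝ := expo p k / (24 * (6 * (p : ℝ) - 1))
  have hc := qPow_ne_zero τ (e + 1 / 24)
  have hf' : ∀ x, f x = qPow τ (e + 1 / 24) *
      ((-1) ^ (x.1 + x.2) * qPow τ 1 ^ posExp p k x.1 x.2) := fun x => by
    rw [hf, qPow_add, qPow_natCast]; ring
  have hg' : ∀ x, g x = qPow τ (e + 1 / 24) *
      ((-1) ^ (x.1 + x.2) * qPow τ 1 ^ negExp p k x.1 x.2) := fun x => by
    rw [hg, qPow_add, qPow_natCast]; ring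
  have hA := (summable_mul_left_iff hc).mp (hfs.congr hf')
  have hB := (summable_mul_left_iff hc).mp (hgs.congr hg')
  convert hasSum_habiro hq hp hk hk' hA hB using 1
  rw [hT, tsum_congr hf', tsum_congr hg', tsum_mul_left, tsum_mul_left, eta_eq, qPow_add τ e]
  have h1 := qPow_ne_zero τ (1 / 24)
  have h2 := qInf_ne_zero hq
  have h3 : qPow τ (-e) * qPow τ e = 1 := by
    rw [← qPow_add, neg_add_cancel]; simp [qPow]
  field_simp
  linear_combination (∑' x : ℕ × ℕ, (-1 : ℂ) ^ (x.1 + x.2) * qPow τ 1 ^ posExp p k x.1 x.2 -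
    ∑' x : ℕ × ℕ, (-1 : ℂ) ^ (x.1 + x.2) * qPow τ 1 ^ negExp p k x.1 x.2) * h3

/-- The identity when `μ_k` has both coordinates in `(0, 1)`: the quadrant of positive coordinates
gives the positive terms of the double series. -/
lemma hasSum_habiro_same {p k : ℕ} (hp : 1 ≤ p) (hk : 1 ≤ k) (hk' : k ≤ 5) (τ : UpperHalfPlane)
    (μ : Fin 2 → ℝ) (h0 : 0 < μ 0 ∧ μ 0 < 1) (h1 : 0 < μ 1 ∧ μ 1 < 1)
    (hpos : ∀ n r : ℕ, form p (n + μ 0) (r + μ 1) =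
      posExp p k n r + (expo p k / (24 * (6 * (p : ℝ) - 1)) + 1 / 24))
    (hneg : ∀ n r : ℕ, form p (-1 - n + μ 0) (-1 - r + μ 1) =
      negExp p k n r + (expo p k / (24 * (6 * (p : ℝ) - 1)) + 1 / 24)) :
    HasSum (fun s : Chain p => habiroTerm p k (qPow τ 1) s.1)
      (qPow τ (-(expo p k / (24 * (6 * (p : ℝ) - 1)))) / (2 * ModularForm.eta (τ : ℂ)) *
        ∑ ε : Fin 2 → Fin 2, (-1 : ℂ) ^ ((ε 0 : ℕ) + (ε 1 : ℕ)) *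
          (falseTheta (matA p) lattice (μ + epsVec ε) (c₁ p) τ +
            falseTheta (matA p) lattice (μ + epsVec ε) (c₂ p) τ)) := by
  refine hasSum_habiro_of_shifted hp hk hk' τ (sum_falseTheta_quadrants hp τ μ 0 0
    (by simpa using h0.1) (by simpa using h0.2) (by simpa using h1.1) (by simpa using h1.2))
    (fun x => ?_) (fun x => ?_)
  · rw [← hpos]; simp
  · rw [← hneg]; simp

/-- The identity when one coordinate of `μ_k` lies in `(-1, 0)` and the other one in `(0, 1)`: the
quadrant of negative coordinates gives the positive terms of the double series. -/
lemma hasSum_habiro_opposite {p k : ℕ} (hp : 1 ≤ p) (hk : 1 ≤ k) (hk' : k ≤ 5)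
    (τ : UpperHalfPlane) (μ : Fin 2 → ℝ) {a b : ℕ} (hab : a + b = 1)
    (h0 : 0 < a + μ 0 ∧ a + μ 0 < 1) (h1 : 0 < b + μ 1 ∧ b + μ 1 < 1)
    (hpos : ∀ n r : ℕ, form p (a - 1 - n + μ 0) (b - 1 - r + μ 1) =
      posExp p k n r + (expo p k / (24 * (6 * (p : ℝ) - 1)) + 1 / 24))
    (hneg : ∀ n r : ℕ, form p (a + n + μ 0) (b + r + μ 1) =
      negExp p k n r + (expo p k / (24 * (6 * (p : ℝ) - 1)) + 1 / 24)) :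
    HasSum (fun s : Chain p => habiroTerm p k (qPow τ 1) s.1)
      (qPow τ (-(expo p k / (24 * (6 * (p : ℝ) - 1)))) / (2 * ModularForm.eta (τ : ℂ)) *
        ∑ ε : Fin 2 → Fin 2, (-1 : ℂ) ^ ((ε 0 : ℕ) + (ε 1 : ℕ)) *
          (falseTheta (matA p) lattice (μ + epsVec ε) (c₁ p) τ +
            falseTheta (matA p) lattice (μ + epsVec ε) (c₂ p) τ)) := by
  obtain ⟨hs1, hs2, hT⟩ := sum_falseTheta_quadrants hp τ μ a b h0.1 h0.2 h1.1 h1.2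
  refine hasSum_habiro_of_shifted hp hk hk' τ ⟨hs2.neg, hs1.neg, ?_⟩ (fun x => ?_) (fun x => ?_)
  · rw [hT, tsum_neg, tsum_neg]; ring
  · rw [hpos, hab]; ring
  · rw [hneg, hab]; ring

lemma hasSum_habiro_falseTheta {p k : ℕ} (hp : 1 ≤ p) (hk : 1 ≤ k) (hk' : k ≤ 5)
    (hpk : ¬ (p = 1 ∧ (k = 1 ∨ k = 3))) (τ : UpperHalfPlane) :
    HasSum (fun s : Chain p => habiroTerm p k (qPow τ 1) s.1)
      (qPow τ (-(expo p k / (24 * (6 * (p : ℝ) - 1)))) / (2 * ModularForm.eta (τ : ℂ)) *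
        ∑ ε : Fin 2 → Fin 2, (-1 : ℂ) ^ ((ε 0 : ℕ) + (ε 1 : ℕ)) *
          (falseTheta (matA p) lattice (shift p k + epsVec ε) (c₁ p) τ +
            falseTheta (matA p) lattice (shift p k + epsVec ε) (c₂ p) τ)) := by
  have hD := six_mul_sub_one_pos hp
  have hD' := hD.ne'
  have hp1 : (1 : ℝ) ≤ p := by exact_mod_cast hp
  have hp2 : k = 1 ∨ k = 3 → (2 : ℝ) ≤ p := fun h => by
    have : 2 ≤ p := by by_contra h'; exact hpk ⟨by omega, h⟩
    exact_mod_cast this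
  -- location of a coordinate `x / (2 (6p - 1))` of the shift
  have hlt : ∀ x : ℝ, ∀ c : ℝ, x < c * (2 * (6 * (p : ℝ) - 1)) →
      (2 * (6 * (p : ℝ) - 1))⁻¹ * x < c := fun x c h => by
    rw [inv_mul_lt_iff₀ (by positivity)]; linarith
  have hgt : ∀ x : ℝ, ∀ c : ℝ, c * (2 * (6 * (p : ℝ) - 1)) < x →
      c < (2 * (6 * (p : ℝ) - 1))⁻¹ * x := fun x c h => by
    rw [lt_inv_mul_iff₀ (by positivity)]; linarith
  rw [shift_eq hp hk hk', one_div]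
  -- keep `6p - 1` as an atom while clearing denominators
  obtain ⟨D, hDp⟩ : ∃ D : ℝ, D = 6 * p - 1 := ⟨_, rfl⟩
  rw [← hDp] at hD hD' hlt hgt
  have hsame := hasSum_habiro_same hp hk hk' τ ((2 * D)⁻¹ • shiftNum p k)
  have hopp := fun a b => hasSum_habiro_opposite hp hk hk' τ ((2 * D)⁻¹ • shiftNum p k)
    (a := a) (b := b)
  rw [← hDp] at hsame ⊢
  simp only [← hDp] at hopp
  interval_cases k
  · have := hp2 (by simp)
    refine hsame ⟨hgt _ _ ?_, hlt _ _ ?_⟩ ⟨hgt _ _ ?_, hlt _ _ ?_⟩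
      (fun n r => ?_) (fun n r => ?_)
    all_goals simp [shiftNum, form, posExp, negExp, expo, Nat.cast_choose_two]
    any_goals linarith
    all_goals field_simp
    all_goals rw [hDp]
    all_goals ring
  · refine hsame ⟨hgt _ _ ?_, hlt _ _ ?_⟩ ⟨hgt _ _ ?_, hlt _ _ ?_⟩
      (fun n r => ?_) (fun n r => ?_)
    all_goals simp [shiftNum, form, posExp, negExp, expo, Nat.cast_choose_two]
    any_goals linarith
    all_goals field_simp
    all_goals rw [hDp]
    all_goals ring
  · have := hp2 (by simp)
    refine hsame ⟨hgt _ _ ?_, hlt _ _ ?_⟩ ⟨hgt _ _ ?_, hlt _ _ ?_⟩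
      (fun n r => ?_) (fun n r => ?_)
    all_goals simp [shiftNum, form, posExp, negExp, expo, Nat.cast_choose_two]
    any_goals linarith
    all_goals field_simp
    all_goals rw [hDp]
    all_goals ring
  · refine hopp 0 1 rfl
      ⟨neg_lt_iff_pos_add'.mp (hgt _ _ ?_), lt_sub_iff_add_lt'.mp (hlt _ _ ?_)⟩
      ⟨neg_lt_iff_pos_add'.mp (hgt _ _ ?_), lt_sub_iff_add_lt'.mp (hlt _ _ ?_)⟩
      (fun n r => ?_) (fun n r => ?_)
    all_goals simp [shiftNum, form, posExp, negExp, expo, Nat.cast_choose_two]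
    any_goals linarith
    all_goals field_simp
    all_goals rw [hDp]
    all_goals ring
  · refine hopp 1 0 rfl
      ⟨neg_lt_iff_pos_add'.mp (hgt _ _ ?_), lt_sub_iff_add_lt'.mp (hlt _ _ ?_)⟩
      ⟨neg_lt_iff_pos_add'.mp (hgt _ _ ?_), lt_sub_iff_add_lt'.mp (hlt _ _ ?_)⟩
      (fun n r => ?_) (fun n r => ?_)
    all_goals simp [shiftNum, form, posExp, negExp, expo, Nat.cast_choose_two]
    any_goals linarith
    all_goals field_simp
    all_goals rw [hDp]
    all_goals ring

end HabiroFalse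

theorem theorem3p9 (p k : ℕ) (hp : 1 ≤ p) (hk : 1 ≤ k) (hk' : k ≤ 5) :
    HabiroFalse.shift p k = (1 / (2 * (6 * (p : ℝ) - 1))) • HabiroFalse.shiftNum p k ∧
    (¬ (p = 1 ∧ (k = 1 ∨ k = 3)) →
      ∀ τ : UpperHalfPlane,
        (Summable fun s : HabiroFalse.Chain p =>
          HabiroFalse.habiroTerm p k (HabiroFalse.qPow τ 1) s.1) ∧
        (∀ ε : Fin 2 → Fin 2, ∀ c ∈ ({HabiroFalse.c₁ p, HabiroFalse.c₂ p} : Set (Fin 2 → ℝ)),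
          Summable fun n : {n : Fin 2 → ℝ //
              n - (HabiroFalse.shift p k + HabiroFalse.epsVec ε) ∈ HabiroFalse.lattice} =>
            HabiroFalse.falseThetaTerm (HabiroFalse.matA p) c τ n.1) ∧
        HabiroFalse.habiro p k (HabiroFalse.qPow τ 1) =
          HabiroFalse.qPow τ (-(HabiroFalse.expo p k / (24 * (6 * (p : ℝ) - 1)))) /
              (2 * ModularForm.eta (τ : ℂ)) *
            ∑ ε : Fin 2 → Fin 2, (-1 : ℂ) ^ ((ε 0 : ℕ) + (ε 1 : ℕ)) *
              (HabiroFalse.falseTheta (HabiroFalse.matA p) HabiroFalse.lattice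
                  (HabiroFalse.shift p k + HabiroFalse.epsVec ε) (HabiroFalse.c₁ p) τ +
                HabiroFalse.falseTheta (HabiroFalse.matA p) HabiroFalse.lattice
                  (HabiroFalse.shift p k + HabiroFalse.epsVec ε) (HabiroFalse.c₂ p) τ)) := by
  refine ⟨HabiroFalse.shift_eq hp hk hk', fun hpk τ => ?_⟩
  have h := HabiroFalse.hasSum_habiro_falseTheta hp hk hk' hpk τ
  exact ⟨h.summable, fun ε c hc => HabiroFalse.summable_falseTheta hp τ _ ε hc, h.tsum_eq⟩
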